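/- **Stronger PRUs.** For each $n\ge 1$ let $K_n$ be a finite nonempty set of keys, written as bit strings, and let $\{U_{n,k}\}_{k\in K_n}$ be $n$-qubit unitaries. Let $\mathcal O$ be a set of query types. The family $\mathcal U=\{U_{n,k}\}$ is a *pseudorandom unitary (PRU) secure against $\mathcal O$ queries* if * (efficient generation) there is a quantum algorithm which, on input $n\ge 1$ and $k\in K_n$, computes the matrix $U_{n,k}$ in time $\mathrm{poly}(n)$; that is, on the further input $m$ it applies, in time $\mathrm{poly}(n+m)$, a circuit that maps $|\psi\rangle|0\rangle$ to $(U_{n,k}|\psi\rangle)|0\rangle$ up to error $2^{-m}$ in operator norm (where $|0\rangle$ is the state of the ancilla qubits); * (indistinguishability from Haar) for every $\mathrm{poly}(n)$-time oracle circuit $A$ all of whose queries are of types in $\mathcal O$, $$\Big|\Pr_{k\sim K_n}[A(U_{n,k})\text{ accepts}]-\Pr_{U\sim \mathrm{Haar}_n}[A(U)\text{ accepts}]\Big|$$ is negligible in $n$, where $k$ is uniform in $K_n$ and $\mathrm{Haar}_n$ is the Haar probability measure on $n$-qubit unitaries. Here a $\mathrm{poly}(n)$-time algorithm is a classical multi-stack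 program with a step count that applies, one after the other, Hadamard gates, NOT, CNOT and Toffoli gates, phase gates $\mathrm{diag}(1,e^{2\pi i/2^j})$ and, for oracle circuits, queries; oracle circuits are either uniform or have an advice string depending only on $n$, and start with all qubits in state $|0\rangle$. Let $S\subseteq\{U,U^\dagger,U^*,U^{\mathsf T}\}$ be any subset, and let $\mathcal U$ be a PRU secure against queries in $S$. Let $q_n=2^n$, let $C_{q_n}=\{e^{2\pi i x/q_n}\mid 0\le x<q_n\}$ and $K_n^+=K_n\times C_{q_n}$, and define $U_{n,(k,\varphi)}=\varphi\cdot U_{n,k}$ for $(k,\varphi)\in K_n^+$. Then $\mathcal U^+=\{U_{n,(k,\varphi)}\}$ is a PRU secure against the corresponding subset of $\{\mathrm{c}U,\mathrm{c}U^\dagger,\mathrm{c}U^*,\mathrm{c}U^{\mathsf T}\}$ queries, where $\mathrm{c}V=|0\rangle\langle 0|\otimes I+|1\rangle\langle 1|\otimes V$. This holds for uniform adversaries (in hypothesis and conclusion), and likewise for adversaries with advice. -/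

import Mathlib

noncomputable section

namespace PRU

open Filter MeasureTheory

/-! ## Queries, gates and circuits -/

/-- The four forms `U`, `U†`, `U*`, `Uᵀ` in which a unitary can be accessed. -/
inductive QueryOp
  | plain
  | adjoint
  | conj
  | transpose

/-- A query type: one of the four forms, either uncontrolled or with a control qubit. -/
inductive Query
  | uncontrolled (o : QueryOp)
  | controlled (o : QueryOp)

/-- Qubits are arranged in countably many arrays; the qubit `(a, i)` is the one at position `i` of
array number `a`. The general form `Gate ι` also serves for the gate-emitting instructions of a
program, where positions are given by registers of the program.

* `not`, `cnot`, `toffoli` are the classical reversible gates (the last argument is the target);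
* `hadamard` is the Hadamard gate;
* `phase j` is the one-qubit gate `diag(1, exp(2πi / 2^j))`;
* `query q` is a call to the oracle. Its target is formed by the qubits `(0, 0), …, (0, n-1)`, and
  its control qubit, if it has one, is `(1, 0)`. -/
inductive Gate (ι : Type)
  | not (a : ℕ × ι)
  | cnot (a b : ℕ × ι)
  | toffoli (a b c : ℕ × ι)
  | hadamard (a : ℕ × ι)
  | phase (j : ι) (a : ℕ × ι)
  | query (q : Query)

/-- The name of a qubit: array number and position. -/
abbrev Wire := ℕ × ℕ

/-- A circuit is the list of its gates, in the order in which they are applied. -/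
abbrev Circuit := List (Gate ℕ)

namespace Gate

/-- Substitution of the positions in a gate. -/
def map {ι κ : Type} (f : ι → κ) : Gate ι → Gate κ
  | not a => not (a.1, f a.2)
  | cnot a b => cnot (a.1, f a.2) (b.1, f b.2)
  | toffoli a b c => toffoli (a.1, f a.2) (b.1, f b.2) (c.1, f c.2)
  | hadamard a => hadamard (a.1, f a.2)
  | phase j a => phase (f j) (a.1, f a.2)
  | query q => query q

/-- The cost of writing down a gate, with positions in unary. -/
def cost : Gate ℕ → ℕ
  | not a => a.2 + 1
  | cnot a b => a.2 + b.2 + 1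
  | toffoli a b c => a.2 + b.2 + c.2 + 1
  | hadamard a => a.2 + 1
  | phase j a => j + a.2 + 1
  | query _ => 1

/-- The gate is an ordinary gate or a query of a type in `Q`. -/
def Allowed (Q : Set Query) {ι : Type} : Gate ι → Prop
  | query q => q ∈ Q
  | _ => True

end Gate

/-- All queries of the circuit are of types in `Q`. -/
def Circuit.Allowed (Q : Set Query) (c : Circuit) : Prop := ∀ g ∈ c, g.Allowed Q

/-! ## Quantum semantics of circuits -/

/-- Pure states. A computational basis state is named by the finite set of the qubits that are `1`
in it (all others are `0`), and a state is a finite linear combination of basis states. -/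
abbrev State := Finset Wire →₀ ℂ

/-- The computational basis state in which exactly the qubits in `s` are `1`. -/
def ket (s : Finset Wire) : State := Finsupp.single s 1

/-- The squared `ℓ²` norm. -/
def normSq (ψ : State) : ℝ := ψ.sum fun _ z => ‖z‖ ^ 2

/-- The `ℓ²` norm. -/
def l2norm (ψ : State) : ℝ := Real.sqrt (normSq ψ)

/-- The linear map with prescribed values on basis states. -/
def extend (f : Finset Wire → State) : State →ₗ[ℂ] State := Finsupp.linearCombination ℂ f

/-- Flip the qubit `w`. -/
def flip (w : Wire) (s : Finset Wire) : Finset Wire := symmDiff s {w}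

/-- The content of the target qubits `(0, 0), …, (0, n-1)` of the oracle. -/
def readTarget (n : ℕ) (s : Finset Wire) : Fin n → Bool := fun i => decide ((0, (i : ℕ)) ∈ s)

/-- Overwrite the target qubits `(0, 0), …, (0, n-1)` of the oracle by `y`. -/
def writeTarget (n : ℕ) (y : Fin n → Bool) (s : Finset Wire) : Finset Wire :=
  (s.filter fun w => ¬ (w.1 = 0 ∧ w.2 < n)) ∪
    (Finset.univ.filter fun i => y i = true).image fun i : Fin n => (0, (i : ℕ))

/-- `2^n × 2^n` matrices, rows and columns indexed by `n`-bit strings. -/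
abbrev QMatrix (n : ℕ) := Matrix (Fin n → Bool) (Fin n → Bool) ℂ

/-- The group of `n`-qubit unitaries. -/
abbrev QUnitary (n : ℕ) := Matrix.unitaryGroup (Fin n → Bool) ℂ

/-- `V`, `V†`, `V*` or `Vᵀ`. -/
def QueryOp.apply {n : ℕ} (V : QMatrix n) : QueryOp → QMatrix n
  | plain => V
  | adjoint => V.conjTranspose
  | conj => V.map star
  | transpose => V.transpose

/-- The action of an `n`-qubit matrix on the target qubits of the oracle, on basis states. -/
def applyTarget {n : ℕ} (V : QMatrix n) (s : Finset Wire) : State :=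
  ∑ y : Fin n → Bool, V y (readTarget n s) • ket (writeTarget n y s)

/-- The action of a gate on basis states, when the oracle is the `n`-qubit matrix `V`. A gate on
several qubits acts as the identity unless these are distinct. -/
def Gate.onBasis {n : ℕ} (V : QMatrix n) : Gate ℕ → Finset Wire → State
  | .not a, s => ket (flip a s)
  | .cnot a b, s => if a ≠ b ∧ a ∈ s then ket (flip b s) else ket s
  | .toffoli a b c, s =>
      if (a ≠ b ∧ a ≠ c ∧ b ≠ c) ∧ a ∈ s ∧ b ∈ s then ket (flip c s) else ket s
  | .hadamard a, s =>
      ((1 / Real.sqrt 2 : ℝ) : ℂ) •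
        (ket (s.erase a) + (if a ∈ s then (-1 : ℂ) else 1) • ket (insert a s))
  | .phase j a, s =>
      if a ∈ s then Complex.exp (2 * Real.pi * Complex.I / 2 ^ j) • ket s else ket s
  | .query (.uncontrolled o), s => applyTarget (o.apply V) s
  | .query (.controlled o), s =>
      if ((1, 0) : Wire) ∈ s then applyTarget (o.apply V) s else ket s

/-- Run a circuit with oracle `V` on a state. -/
def runCircuit {n : ℕ} (V : QMatrix n) (c : Circuit) (ψ : State) : State :=
  c.foldl (fun ψ g => extend (g.onBasis V) ψ) ψ

/-- The probability that a circuit with oracle `V`, started with all qubits in state `0`, accepts: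
the final measurement of the output qubit `(2, 0)` gives `1`. -/
def acceptProb {n : ℕ} (V : QMatrix n) (c : Circuit) : ℝ :=
  normSq ((runCircuit V c (ket ∅)).filter fun s => ((2, 0) : Wire) ∈ s)

/-- The `n`-qubit vector `ψ` on the qubits `(0, 0), …, (0, n-1)`, all other qubits being `0`. -/
def embed {n : ℕ} (ψ : (Fin n → Bool) → ℂ) : State :=
  ∑ x : Fin n → Bool, ψ x • ket (writeTarget n x ∅)

/-- The circuit computes the matrix `W` up to error `ε` in operator norm: it takes `|ψ⟩|0⟩`
to `(W|ψ⟩)|0⟩`, the second factor being the ancilla qubits. -/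
def Computes {n : ℕ} (c : Circuit) (W : QMatrix n) (ε : ℝ) : Prop :=
  ∀ ψ : (Fin n → Bool) → ℂ,
    l2norm (runCircuit (1 : QMatrix n) c (embed ψ) - embed (W.mulVec ψ)) ≤ ε * l2norm (embed ψ)

/-! ## Algorithms

A quantum algorithm is a classical program with an explicit step count, which applies quantum gates
one after the other. The classical machine is a multi-stack machine in structured form: it has
finitely many registers (those mentioned in the program), each holding a stack of bits. -/

/-- Programs. `branch r p q t` runs `p` if register `r` is empty, `q` if its top bit is `0` and `t`
if its top bit is `1`. `loop r p` repeats `p` as long as register `r` is not empty. `emit g` applies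
the gate `g`, in which positions (and the `j` of a phase gate) are given by the heights of the named
registers. -/
inductive Prog
  | skip
  | push (r : ℕ) (b : Bool)
  | pop (r : ℕ)
  | emit (g : Gate ℕ)
  | seq (p q : Prog)
  | branch (r : ℕ) (p q t : Prog)
  | loop (r : ℕ) (p : Prog)

/-- The content of the registers, top of the stack first. -/
abbrev Store := ℕ → List Bool

/-- `Exec P s c t s'`: started on the store `s`, the program `P` halts after `t` steps with the
store `s'`, having applied the gates of the circuit `c`. -/
inductive Exec : Prog → Store → Circuit → ℕ → Store → Prop
  | skip (s : Store) : Exec .skip s [] 1 s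
  | push (r : ℕ) (b : Bool) (s : Store) :
      Exec (.push r b) s [] 1 (Function.update s r (b :: s r))
  | pop (r : ℕ) (s : Store) :
      Exec (.pop r) s [] 1 (Function.update s r (s r).tail)
  | emit (g : Gate ℕ) (s : Store) :
      Exec (.emit g) s [g.map fun r => (s r).length] (g.map fun r => (s r).length).cost s
  | seq {p q : Prog} {s s₁ s₂ : Store} {c₁ c₂ : Circuit} {t₁ t₂ : ℕ} :
      Exec p s c₁ t₁ s₁ → Exec q s₁ c₂ t₂ s₂ → Exec (.seq p q) s (c₁ ++ c₂) (t₁ + t₂) s₂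
  | branchEmpty {r : ℕ} {p q u : Prog} {s s₁ : Store} {c : Circuit} {t : ℕ} :
      s r = [] → Exec p s c t s₁ → Exec (.branch r p q u) s c (t + 1) s₁
  | branchFalse {r : ℕ} {p q u : Prog} {s s₁ : Store} {c : Circuit} {t : ℕ} :
      (s r).head? = some false → Exec q s c t s₁ → Exec (.branch r p q u) s c (t + 1) s₁
  | branchTrue {r : ℕ} {p q u : Prog} {s s₁ : Store} {c : Circuit} {t : ℕ} :
      (s r).head? = some true → Exec u s c t s₁ → Exec (.branch r p q u) s c (t + 1) s₁
  | loopDone {r : ℕ} {p : Prog} {s : Store} :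
      s r = [] → Exec (.loop r p) s [] 1 s
  | loopStep {r : ℕ} {p : Prog} {s s₁ s₂ : Store} {c₁ c₂ : Circuit} {t₁ t₂ : ℕ} :
      s r ≠ [] → Exec p s c₁ t₁ s₁ → Exec (.loop r p) s₁ c₂ t₂ s₂ →
        Exec (.loop r p) s (c₁ ++ c₂) (t₁ + t₂ + 1) s₂

/-- The initial store: `n` in unary in register `0`, a bit string (a key or an advice string) in
register `1`, a second number `m` in unary in register `2`; the other registers are empty. -/
def inputStore (n : ℕ) (w : List Bool) (m : ℕ) : Store
  | 0 => List.replicate n true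
  | 1 => w
  | 2 => List.replicate m true
  | _ => []

/-! ## Pseudorandom unitaries -/

/-- A family `{U_{n,k}}` of `n`-qubit unitaries `U_{n,k}`, for `k` in a finite set of keys `K_n`.
Keys are written as bit strings. (The entries for `n = 0` play no role.) -/
structure UnitaryFamily where
  Key : ℕ → Type
  fintypeKey : ∀ n, Fintype (Key n)
  nonemptyKey : ∀ n, Nonempty (Key n)
  encode : ∀ n, Key n → List Bool
  encode_injective : ∀ n, Function.Injective (encode n)
  unitary : ∀ n, Key n → QUnitary n

attribute [instance] UnitaryFamily.fintypeKey UnitaryFamily.nonemptyKey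

/-- Efficient generation: there is an algorithm which, on input `n ≥ 1`, a key `k ∈ K_n` and an
accuracy parameter `m`, computes `U_{n,k}` up to error `2^{-m}`, in time polynomial in `n` and `m`
(the accuracy parameter makes the notion independent of the choice of a universal gate set). -/
def UnitaryFamily.EfficientlyGenerated (𝒰 : UnitaryFamily) : Prop :=
  ∃ (P : Prog) (p : Polynomial ℕ), ∀ n : ℕ, 1 ≤ n → ∀ (k : 𝒰.Key n) (m : ℕ),
    ∃ (c : Circuit) (t : ℕ) (s : Store),
      Exec P (inputStore n (𝒰.encode n k) m) c t s ∧ t ≤ p.eval (n + m) ∧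
        c.Allowed ∅ ∧ Computes c (𝒰.unitary n k : QMatrix n) ((1 / 2 : ℝ) ^ m)

/-- Whether adversaries are uniform, or get an advice string that depends on `n` only. -/
inductive Uniformity
  | uniform
  | nonuniform

/-- The advice strings an adversary may have. -/
def Uniformity.Admits : Uniformity → (ℕ → List Bool) → Prop
  | uniform, a => ∀ n, a n = []
  | nonuniform, _ => True

/-- `c` is a polynomial-time oracle circuit (family) with queries of types in `Q`: the circuit `c n`
is produced and run by one fixed program in time polynomial in `n`. -/
def IsEfficientOracleCircuit (Q : Set Query) (u : Uniformity) (c : ℕ → Circuit) : Prop :=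
  ∃ (P : Prog) (p : Polynomial ℕ) (a : ℕ → List Bool), u.Admits a ∧ ∀ n : ℕ, 1 ≤ n →
    (c n).Allowed Q ∧ ∃ (t : ℕ) (s : Store), Exec P (inputStore n (a n) 0) (c n) t s ∧ t ≤ p.eval n

instance (n : ℕ) : CompactSpace (QUnitary n) := by
  refine isCompact_iff_compactSpace.mp ?_
  have hK : IsCompact (Set.univ.pi fun _ : Fin n → Bool =>
      Set.univ.pi fun _ : Fin n → Bool => Metric.closedBall (0 : ℂ) 1) :=
    isCompact_univ_pi fun _ => isCompact_univ_pi fun _ => isCompact_closedBall _ _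
  refine hK.of_isClosed_subset (isClosed_unitary (R := QMatrix n)) fun V hV => ?_
  simp only [Set.mem_pi, Set.mem_univ, forall_true_left, mem_closedBall_zero_iff]
  exact fun i j => entry_norm_bound_of_unitary hV i j

instance (n : ℕ) : MeasurableSpace (QUnitary n) := borel _

instance (n : ℕ) : BorelSpace (QUnitary n) := ⟨rfl⟩

/-- The Haar probability measure on `n`-qubit unitaries. -/
def haar (n : ℕ) : Measure (QUnitary n) := Measure.haarMeasure ⊤

/-- The probability that `c` accepts on `U_{n,k}` for a uniformly random key `k ∈ K_n`. -/
def UnitaryFamily.keyAcceptProb (𝒰 : UnitaryFamily) (n : ℕ) (c : Circuit) : ℝ :=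
  (∑ k : 𝒰.Key n, acceptProb (𝒰.unitary n k : QMatrix n) c) / Fintype.card (𝒰.Key n)

/-- The probability that `c` accepts on a Haar-random `n`-qubit unitary. -/
def haarAcceptProb (n : ℕ) (c : Circuit) : ℝ :=
  ∫ V : QUnitary n, acceptProb (V : QMatrix n) c ∂(haar n)

/-- A negligible function: it decays faster than every inverse polynomial. -/
def Negligible (f : ℕ → ℝ) : Prop :=
  Asymptotics.SuperpolynomialDecay atTop (fun n : ℕ => (n : ℝ)) f

/-- Indistinguishability from Haar for efficient adversaries with queries of types in `Q`. -/
def UnitaryFamily.IndistinguishableFromHaar (𝒰 : UnitaryFamily) (Q : Set Query) (u : Uniformity) :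
    Prop :=
  ∀ c : ℕ → Circuit, IsEfficientOracleCircuit Q u c →
    Negligible fun n => |𝒰.keyAcceptProb n (c n) - haarAcceptProb n (c n)|

/-- `𝒰` is a pseudorandom unitary, secure against queries of types in `Q`. -/
def UnitaryFamily.IsPRU (𝒰 : UnitaryFamily) (Q : Set Query) (u : Uniformity) : Prop :=
  𝒰.EfficientlyGenerated ∧ 𝒰.IndistinguishableFromHaar Q u

/-! ## Multiplication by a random phase -/

/-- The phase `exp(2πi x / 2^n)`. These are the `2^n`-th roots of unity. -/
def rootPhase (n : ℕ) (x : Fin (2 ^ n)) : ℂ :=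
  Complex.exp (2 * Real.pi * Complex.I * ((x : ℕ) : ℂ) / 2 ^ n)

theorem rootPhase_mul_star (n : ℕ) (x : Fin (2 ^ n)) : rootPhase n x * star (rootPhase n x) = 1 := by
  have h : rootPhase n x = Complex.exp (((2 * Real.pi * ((x : ℕ) : ℝ) / 2 ^ n : ℝ) : ℂ) * Complex.I) := by
    unfold rootPhase
    congr 1
    push_cast
    ring
  have h1 : ‖rootPhase n x‖ = 1 := by rw [h, Complex.norm_exp_ofReal_mul_I]
  have h2 : rootPhase n x * star (rootPhase n x) = ((‖rootPhase n x‖ ^ 2 : ℝ) : ℂ) := by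
    push_cast
    exact Complex.mul_conj' _
  rw [h2, h1]
  simp

/-- The unitary `φ · V`, where `φ` is the root of unity number `x`. -/
def phaseMul {n : ℕ} (x : Fin (2 ^ n)) (V : QUnitary n) : QUnitary n :=
  ⟨rootPhase n x • (V : QMatrix n), by
    rw [Matrix.mem_unitaryGroup_iff, star_smul, Matrix.smul_mul, Matrix.mul_smul, smul_smul,
      rootPhase_mul_star, one_smul]
    exact Matrix.mem_unitaryGroup_iff.mp V.2⟩

/-- The `n` binary digits of `x`, least significant first. -/
def bits (n : ℕ) (x : Fin (2 ^ n)) : List Bool := List.ofFn fun i : Fin n => (x : ℕ).testBit i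

theorem bits_injective (n : ℕ) : Function.Injective (bits n) := by
  intro x y h
  have h' := List.ofFn_injective h
  apply Fin.ext
  apply Nat.eq_of_testBit_eq
  intro i
  by_cases hi : i < n
  · exact congrFun h' ⟨i, hi⟩
  · have hp : 2 ^ n ≤ 2 ^ i := Nat.pow_le_pow_right (by norm_num) (not_lt.mp hi)
    rw [Nat.testBit_lt_two_pow (x.2.trans_le hp), Nat.testBit_lt_two_pow (y.2.trans_le hp)]

/-- The family `𝒰⁺`: keys are pairs of a key `k` and a `2^n`-th root of unity `φ` (given by its
number `x`, and written in front of `k` with `n` bits), and the unitary is `φ · U_{n,k}`. -/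
def UnitaryFamily.withPhase (𝒰 : UnitaryFamily) : UnitaryFamily where
  Key n := 𝒰.Key n × Fin (2 ^ n)
  fintypeKey _ := inferInstance
  nonemptyKey _ := inferInstance
  encode n kx := bits n kx.2 ++ 𝒰.encode n kx.1
  encode_injective n := by
    rintro ⟨k, x⟩ ⟨l, y⟩ h
    obtain ⟨h1, h2⟩ := List.append_inj h (by simp [bits])
    rw [Prod.mk.injEq]
    exact ⟨𝒰.encode_injective n h2, bits_injective n h1⟩
  unitary n kx := phaseMul kx.2 (𝒰.unitary n kx.1)

end PRU

end

/-!
A controlled query is simulated with one uncontrolled query and an ancilla in the state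
`∑ x, |x⟩|x⟩`: if the control qubit is `1`, the query is applied to the target, otherwise to one
half of the ancilla, which turns `∑ x y, (V^j)_{yx} |y⟩|x⟩` into the same state for `V^(j+1)` or
`V^(j-1)`. A counter is moved along so that, if the adversary makes `N` queries and `A_k` is the
coefficient of `φ ^ k` in its final state on `φ V`, up to a shift of the exponents, the simulation
on `V` ends in the orthogonal sum over `k` of `A_k`, the entangled state of `V^(N-k)`, and the
counter at `k`. Averaging the acceptance probability on `φ V` over the `2 ^ n`-th roots of unity `φ`
also removes the cross terms of different `A_k`, as soon as `N < 2 ^ n`. So for every `V` the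
simulation accepts `V` with exactly this average probability, and Haar measure is invariant under
multiplication by `φ`.
-/

noncomputable section

namespace PRU

open Filter MeasureTheory

/-! ## Linear semantics of circuits -/

theorem extend_ket (f : Finset Wire → State) (s : Finset Wire) : extend f (ket s) = f s := by
  simp [extend, ket]

theorem hom_ext_ket {f g : State →ₗ[ℂ] State} (h : ∀ s, f (ket s) = g (ket s)) : f = g :=
  Finsupp.lhom_ext' fun s => LinearMap.ext_ring <| by simpa [ket] using h s

/-- The linear map on states given by a circuit with oracle `V`, the bundled form of
`runCircuit V`. -/
def runLin {n : ℕ} (V : QMatrix n) : Circuit → State →ₗ[ℂ] State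
  | [] => LinearMap.id
  | g :: c => runLin V c ∘ₗ extend (g.onBasis V)

theorem runCircuit_eq_runLin {n : ℕ} (V : QMatrix n) (c : Circuit) (ψ : State) :
    runCircuit V c ψ = runLin V c ψ := by
  induction c generalizing ψ with
  | nil => rfl
  | cons g _ ih => exact ih _

theorem runLin_cons {n : ℕ} (V : QMatrix n) (g : Gate ℕ) (c : Circuit) (ψ : State) :
    runLin V (g :: c) ψ = runLin V c (extend (g.onBasis V) ψ) := rfl

theorem runLin_append {n : ℕ} (V : QMatrix n) (c d : Circuit) (ψ : State) :
    runLin V (c ++ d) ψ = runLin V d (runLin V c ψ) := by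
  induction c generalizing ψ with
  | nil => rfl
  | cons g _ ih => exact ih _

theorem runLin_singleton_ket {n : ℕ} (V : QMatrix n) (g : Gate ℕ) (s : Finset Wire) :
    runLin V [g] (ket s) = g.onBasis V s :=
  extend_ket _ s

theorem mem_flip {w a : Wire} {s : Finset Wire} : w ∈ flip a s ↔ ¬ (w ∈ s ↔ w = a) := by
  simp only [flip, Finset.mem_symmDiff, Finset.mem_singleton]
  tauto

theorem mem_flip_self {a : Wire} {s : Finset Wire} : a ∈ flip a s ↔ a ∉ s := by
  simp [mem_flip]

theorem flip_flip (a : Wire) (s : Finset Wire) : flip a (flip a s) = s := by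
  simp [flip]

/-! ## Registers of qubits -/

/-- The basis state in which array `a` holds the bit string `y` and all other qubits are `0`. -/
def block {n : ℕ} (a : ℕ) (y : Fin n → Bool) : Finset Wire :=
  (Finset.univ.filter fun i => y i = true).image fun i : Fin n => (a, (i : ℕ))

theorem mem_block {n : ℕ} {a : ℕ} {y : Fin n → Bool} {w : Wire} :
    w ∈ block a y ↔ w.1 = a ∧ ∃ h : w.2 < n, y ⟨w.2, h⟩ = true := by
  simp only [block, Finset.mem_image, Finset.mem_filter, Finset.mem_univ, true_and]
  constructor
  · rintro ⟨j, hj, rfl⟩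
    exact ⟨rfl, j.2, hj⟩
  · rintro ⟨rfl, h, hy⟩
    exact ⟨_, hy, rfl⟩

/-- The first `n` qubits of array `d`. The case `d = 0` is `readTarget`. -/
def readArray (d n : ℕ) (s : Finset Wire) : Fin n → Bool := fun i => decide ((d, (i : ℕ)) ∈ s)

/-- Overwrite the first `n` qubits of array `d` by `y`. The case `d = 0` is `writeTarget`. -/
def writeArray (d : ℕ) {n : ℕ} (y : Fin n → Bool) (s : Finset Wire) : Finset Wire :=
  (s.filter fun w => ¬ (w.1 = d ∧ w.2 < n)) ∪ block d y

theorem mem_writeArray {d n : ℕ} {y : Fin n → Bool} {s : Finset Wire} {w : Wire} :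
    w ∈ writeArray d y s ↔
      (w ∈ s ∧ ¬ (w.1 = d ∧ w.2 < n)) ∨ (w.1 = d ∧ ∃ h : w.2 < n, y ⟨w.2, h⟩ = true) := by
  simp only [writeArray, Finset.mem_union, mem_block, Finset.mem_filter]

/-- The action of an `n`-qubit matrix on the first `n` qubits of array `d`, on basis states. The
case `d = 0` is `applyTarget`. -/
def applyArray (d : ℕ) {n : ℕ} (V : QMatrix n) (s : Finset Wire) : State :=
  ∑ y : Fin n → Bool, V y (readArray d n s) • ket (writeArray d y s)

theorem applyArray_zero {n : ℕ} (V : QMatrix n) : applyArray 0 V = applyTarget V := rfl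

/-- The qubits of `s` in the arrays below `M`, and those of `R` in the other arrays. -/
def splice (M : ℕ) (R s : Finset Wire) : Finset Wire :=
  s.filter (fun w => w.1 < M) ∪ R.filter fun w => M ≤ w.1

theorem mem_splice {M : ℕ} {R s : Finset Wire} {w : Wire} :
    w ∈ splice M R s ↔ if w.1 < M then w ∈ s else w ∈ R := by
  simp only [splice, Finset.mem_union, Finset.mem_filter]
  grind

theorem splice_splice (M : ℕ) (R R' s : Finset Wire) :
    splice M R (splice M R' s) = splice M R s := by
  ext w
  simp only [mem_splice]
  split_ifs <;> rfl

/-- Replacement of the arrays from `M` on by `R`, as a linear map. -/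
def spliceLin (M : ℕ) (R : Finset Wire) : State →ₗ[ℂ] State :=
  Finsupp.lmapDomain ℂ ℂ (splice M R)

theorem spliceLin_ket (M : ℕ) (R s : Finset Wire) :
    spliceLin M R (ket s) = ket (splice M R s) :=
  Finsupp.mapDomain_single

/-! ## Gates on the arrays below `M` -/

/-- The arrays addressed by the gate are below `M`. -/
def Gate.ArraysLT {ι : Type} (M : ℕ) : Gate ι → Prop
  | .not a => a.1 < M
  | .cnot a b => a.1 < M ∧ b.1 < M
  | .toffoli a b c => a.1 < M ∧ b.1 < M ∧ c.1 < M
  | .hadamard a => a.1 < M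
  | .phase _ a => a.1 < M
  | .query _ => 1 < M

section Splice

variable {M : ℕ} {a : Wire}

theorem mem_splice_of_lt (ha : a.1 < M) (R s : Finset Wire) : a ∈ splice M R s ↔ a ∈ s := by
  rw [mem_splice, if_pos ha]

theorem flip_splice (ha : a.1 < M) (R s : Finset Wire) :
    flip a (splice M R s) = splice M R (flip a s) := by
  ext w
  simp only [mem_splice, mem_flip]
  split_ifs with h
  · rfl
  · have : w ≠ a := fun e => h (e ▸ ha)
    simp [this]

theorem insert_splice (ha : a.1 < M) (R s : Finset Wire) :
    insert a (splice M R s) = splice M R (insert a s) := by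
  ext w
  simp only [mem_splice, Finset.mem_insert]
  split_ifs with h
  · rfl
  · have : w ≠ a := fun e => h (e ▸ ha)
    simp [this]

theorem erase_splice (ha : a.1 < M) (R s : Finset Wire) :
    (splice M R s).erase a = splice M R (s.erase a) := by
  ext w
  simp only [mem_splice, Finset.mem_erase]
  split_ifs with h
  · rfl
  · have : w ≠ a := fun e => h (e ▸ ha)
    simp [this]

theorem writeArray_splice {d n : ℕ} (hd : d < M) (y : Fin n → Bool) (R s : Finset Wire) :
    writeArray d y (splice M R s) = splice M R (writeArray d y s) := by
  ext w
  simp only [mem_splice, mem_writeArray]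
  split_ifs with h
  · rfl
  · have : w.1 ≠ d := fun e => h (e ▸ hd)
    simp [this]

theorem applyArray_splice {d n : ℕ} (hd : d < M) (V : QMatrix n) (R s : Finset Wire) :
    applyArray d V (splice M R s) = spliceLin M R (applyArray d V s) := by
  have hread : readArray d n (splice M R s) = readArray d n s :=
    funext fun i => decide_eq_decide.mpr (mem_splice_of_lt hd R s)
  simp only [applyArray, hread, map_sum, map_smul, spliceLin_ket, writeArray_splice hd]

theorem Gate.onBasis_splice {n : ℕ} (V : QMatrix n) {g : Gate ℕ} (hg : g.ArraysLT M)
    (R s : Finset Wire) : g.onBasis V (splice M R s) = spliceLin M R (g.onBasis V s) := by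
  cases g with
  | not a => simp only [onBasis, spliceLin_ket, flip_splice hg]
  | cnot a b =>
    simp only [onBasis, mem_splice_of_lt hg.1, apply_ite (spliceLin M R), spliceLin_ket,
      flip_splice hg.2]
  | toffoli a b c =>
    simp only [onBasis, mem_splice_of_lt hg.1, mem_splice_of_lt hg.2.1,
      apply_ite (spliceLin M R), spliceLin_ket, flip_splice hg.2.2]
  | hadamard a =>
    simp only [onBasis, mem_splice_of_lt hg, erase_splice hg, insert_splice hg, map_smul, map_add,
      spliceLin_ket]
  | phase j a =>
    simp only [onBasis, mem_splice_of_lt hg, apply_ite (spliceLin M R), map_smul, spliceLin_ket]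
  | query q =>
    have h0 : 0 < M := lt_trans zero_lt_one hg
    cases q with
    | uncontrolled o =>
      simp only [onBasis, ← applyArray_zero, applyArray_splice h0]
    | controlled o =>
      simp only [onBasis, ← applyArray_zero, applyArray_splice h0, spliceLin_ket,
        mem_splice_of_lt (a := (1, 0)) hg, apply_ite (spliceLin M R)]

theorem extend_spliceLin {n : ℕ} (V : QMatrix n) {g : Gate ℕ} (hg : g.ArraysLT M)
    (R : Finset Wire) (ψ : State) :
    extend (g.onBasis V) (spliceLin M R ψ) = spliceLin M R (extend (g.onBasis V) ψ) := by
  suffices extend (g.onBasis V) ∘ₗ spliceLin M R = spliceLin M R ∘ₗ extend (g.onBasis V) from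
    LinearMap.congr_fun this ψ
  refine hom_ext_ket fun s => ?_
  simp only [LinearMap.comp_apply, spliceLin_ket, extend_ket, Gate.onBasis_splice V hg]

end Splice

/-! ## Exchange of two arrays -/

/-- `f (v - 1)`, …, `f 0`, one after the other. -/
def descend (f : ℕ → Circuit) : ℕ → Circuit
  | 0 => []
  | v + 1 => f v ++ descend f v

/-- Swap of the qubits `(0, i)` and `(d, i)`, controlled by `(1, 0)`. -/
def ctrlSwap (d i : ℕ) : Circuit :=
  [.cnot (d, i) (0, i), .toffoli (1, 0) (0, i) (d, i), .cnot (d, i) (0, i)]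

/-- The permutation of the qubits that exchanges the first `v` qubits of the arrays `0` and `d`. -/
def arraySwap (d v : ℕ) : Equiv.Perm Wire :=
  Function.Involutive.toPerm (fun w => if w.2 < v then (Equiv.swap 0 d w.1, w.2) else w)
    fun w => by by_cases h : w.2 < v <;> simp [h]

theorem arraySwap_apply (d v : ℕ) (w : Wire) :
    arraySwap d v w = if w.2 < v then (Equiv.swap 0 d w.1, w.2) else w := rfl

theorem arraySwap_succ (d v : ℕ) :
    arraySwap d (v + 1) = (Equiv.swap (d, v) (0, v)).trans (arraySwap d v) := by
  ext1 ⟨a, i⟩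
  simp only [Equiv.trans_apply, arraySwap_apply, Equiv.swap_apply_def]
  grind

theorem mem_map_arraySwap {d v : ℕ} {s : Finset Wire} {w : Wire} :
    w ∈ s.map (arraySwap d v).toEmbedding ↔ arraySwap d v w ∈ s :=
  Finset.mem_map_equiv

theorem map_arraySwap_map_arraySwap (d v : ℕ) (s : Finset Wire) :
    (s.map (arraySwap d v).toEmbedding).map (arraySwap d v).toEmbedding = s := by
  ext w
  simp only [mem_map_arraySwap, arraySwap_apply]
  split_ifs <;> simp_all

theorem onBasis_cnot {n : ℕ} (V : QMatrix n) {a b : Wire} (hab : a ≠ b) (s : Finset Wire) :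
    (Gate.cnot a b).onBasis V s = ket (if a ∈ s then flip b s else s) := by
  simp only [Gate.onBasis, ne_eq, hab, not_false_eq_true, true_and, apply_ite ket]

theorem onBasis_toffoli {n : ℕ} (V : QMatrix n) {a b c : Wire} (hab : a ≠ b) (hac : a ≠ c)
    (hbc : b ≠ c) (s : Finset Wire) :
    (Gate.toffoli a b c).onBasis V s = ket (if a ∈ s ∧ b ∈ s then flip c s else s) := by
  simp only [Gate.onBasis, ne_eq, hab, hac, hbc, not_false_eq_true, true_and, apply_ite ket]

theorem runLin_cnot_toffoli_cnot {n : ℕ} (V : QMatrix n) {a b c : Wire} (hab : a ≠ b)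
    (hca : c ≠ a) (hcb : c ≠ b) (s : Finset Wire) :
    runLin V [.cnot a b, .toffoli c b a, .cnot a b] (ket s) =
      ket (if c ∈ s then s.map (Equiv.swap a b).toEmbedding else s) := by
  simp only [runLin_cons, extend_ket, onBasis_cnot V hab, onBasis_toffoli V hcb hca hab.symm]
  refine congrArg ket (Finset.ext fun w => ?_)
  have hswap : w ∈ s.map (Equiv.swap a b).toEmbedding ↔ Equiv.swap a b w ∈ s :=
    Finset.mem_map_equiv
  grind [mem_flip]

theorem runLin_descend_ctrlSwap {n : ℕ} (V : QMatrix n) {d : ℕ} (hd : 1 < d) (v : ℕ)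
    (s : Finset Wire) :
    runLin V (descend (ctrlSwap d) v) (ket s) =
      ket (if ((1, 0) : Wire) ∈ s then s.map (arraySwap d v).toEmbedding else s) := by
  have hd0 : d ≠ 0 := by omega
  have hd1 : 1 ≠ d := by omega
  induction v generalizing s with
  | zero =>
    have : arraySwap d 0 = Equiv.refl _ := Equiv.ext fun w => by simp [arraySwap_apply]
    simp [descend, runLin, this]
  | succ v ih =>
    rw [descend, runLin_append, ctrlSwap, runLin_cnot_toffoli_cnot V (by simp [hd0])
      (by simp [hd1]) (by simp), ih]
    by_cases h : ((1, 0) : Wire) ∈ s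
    · have hctrl : ((1, 0) : Wire) ∈ s.map (Equiv.swap (d, v) (0, v)).toEmbedding := by
        rwa [Finset.mem_map_equiv, Equiv.symm_swap,
          Equiv.swap_apply_of_ne_of_ne (by simp [hd1]) (by simp)]
      rw [if_pos h, if_pos hctrl, if_pos h, Finset.map_map, arraySwap_succ]
      rfl
    · simp only [if_neg h]

theorem applyTarget_map_arraySwap (d : ℕ) {n : ℕ} (V : QMatrix n) (s : Finset Wire) :
    applyTarget V (s.map (arraySwap d n).toEmbedding) =
      ∑ y, V y (readArray d n s) • ket ((writeArray d y s).map (arraySwap d n).toEmbedding) := by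
  have hread : readArray 0 n (s.map (arraySwap d n).toEmbedding) = readArray d n s := by
    funext i
    simp only [readArray, mem_map_arraySwap, arraySwap_apply]
    simp
  have hwrite (y : Fin n → Bool) : writeArray 0 y (s.map (arraySwap d n).toEmbedding) =
      (writeArray d y s).map (arraySwap d n).toEmbedding := by
    ext w
    have hfst : Equiv.swap 0 d w.1 = d ↔ w.1 = 0 := by
      rw [Equiv.swap_apply_eq_iff, Equiv.swap_apply_right]
    simp only [mem_writeArray, mem_map_arraySwap, arraySwap_apply]
    by_cases h : w.2 < n <;> simp [h, hfst]
  simp only [← applyArray_zero, applyArray, hread, hwrite]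

/-! ## The counter -/

/-- The gates of the counter on array `C`: `descend (counterGate C) v` adds to each of the qubits
`(C, 1), …, (C, v)` the previous one, if `(1, 0)` is `1`. -/
def counterGate (C i : ℕ) : Circuit := [.toffoli (1, 0) (C, i) (C, i + 1)]

/-- The counter `T` becomes the symmetric difference of `T` and `T + 1`. As a polynomial over the
field with two elements, it is multiplied by `1 + X`. -/
def counterStep (T : Finset ℕ) : Finset ℕ := symmDiff T (T.map (addRightEmbedding 1))

/-- The value of the counter after `k` steps, starting from `{0}`. -/
def counter (k : ℕ) : Finset ℕ := counterStep^[k] {0}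

theorem counter_add (k e : ℕ) : counter (k + e) = counterStep^[e] (counter k) := by
  rw [counter, counter, add_comm, Function.iterate_add_apply]

theorem mem_counterStep {T : Finset ℕ} {i : ℕ} :
    i ∈ counterStep T ↔ ¬ (i ∈ T ↔ 1 ≤ i ∧ i - 1 ∈ T) := by
  simp only [counterStep, Finset.mem_symmDiff, Finset.mem_map, addRightEmbedding_apply]
  grind

/-- As a polynomial, the counter is `(1 + X) ^ k`, which is monic of degree `k`. -/
theorem isGreatest_counter (k : ℕ) : IsGreatest (counter k : Set ℕ) k := by
  induction k with
  | zero => simp [counter]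
  | succ k ih =>
    have hk : k ∈ counter k := ih.1
    have hle : ∀ i ∈ counter k, i ≤ k := ih.2
    simp only [counter_add k 1, Function.iterate_one, IsGreatest, upperBounds, Finset.mem_coe,
      mem_counterStep, Set.mem_ofPred_eq]
    grind

theorem counter_injective : Function.Injective counter := fun k l h =>
  (isGreatest_counter k).unique (h ▸ isGreatest_counter l)

theorem runLin_descend_counterGate {n : ℕ} (V : QMatrix n) {C : ℕ} (hC : 1 < C) (v : ℕ)
    (s : Finset Wire) :
    ∃ s', runLin V (descend (counterGate C) v) (ket s) = ket s' ∧
      ∀ w, w ∈ s' ↔ ¬ (w ∈ s ↔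
        ((1, 0) : Wire) ∈ s ∧ w.1 = C ∧ 1 ≤ w.2 ∧ w.2 ≤ v ∧ (C, w.2 - 1) ∈ s) := by
  induction v generalizing s with
  | zero => exact ⟨s, rfl, by grind⟩
  | succ v ih =>
    rw [descend, runLin_append, counterGate, runLin_singleton_ket,
      onBasis_toffoli V (by simp [hC.ne]) (by simp [hC.ne]) (by simp)]
    obtain ⟨s', hrun, hmem⟩ := ih (if (1, 0) ∈ s ∧ (C, v) ∈ s then flip (C, v + 1) s else s)
    refine ⟨s', hrun, fun w => ?_⟩
    have hstep (w : Wire) : (w ∈ if (1, 0) ∈ s ∧ (C, v) ∈ s then flip (C, v + 1) s else s) ↔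
        ¬ (w ∈ s ↔ ((1, 0) ∈ s ∧ (C, v) ∈ s) ∧ w = (C, v + 1)) := by
      split_ifs with h <;> simp [mem_flip, h]
    obtain ⟨a, i⟩ := w
    simp only [hmem, hstep, Prod.mk.injEq, hC.ne]
    clear ih hmem hrun hstep
    grind

/-! ## Controlled queries simulated by uncontrolled ones -/

/-- Ancilla registers on the arrays `M`, `M + 1` and `M + 2`, holding the two halves `y` and `x` of
an entangled pair and the counter `T`. -/
def ancilla (M : ℕ) {n : ℕ} (y x : Fin n → Bool) (T : Finset ℕ) : Finset Wire :=
  block M y ∪ block (M + 1) x ∪ T.image fun i => (M + 2, i)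

theorem mem_ancilla {M n : ℕ} {y x : Fin n → Bool} {T : Finset ℕ} {w : Wire} :
    w ∈ ancilla M y x T ↔
      (w.1 = M ∧ ∃ h : w.2 < n, y ⟨w.2, h⟩ = true) ∨
        (w.1 = M + 1 ∧ ∃ h : w.2 < n, x ⟨w.2, h⟩ = true) ∨ (w.1 = M + 2 ∧ w.2 ∈ T) := by
  have : (∃ i ∈ T, (M + 2, i) = w) ↔ w.1 = M + 2 ∧ w.2 ∈ T := by grind
  simp only [ancilla, Finset.mem_union, mem_block, Finset.mem_image, this, or_assoc]

section Ancilla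

variable {M n : ℕ} (y x z : Fin n → Bool) (T : Finset ℕ) (s : Finset Wire)

theorem readArray_ancilla_left : readArray M n (splice M (ancilla M y x T) s) = y := by
  funext i
  simp [readArray, mem_splice, mem_ancilla]

theorem readArray_ancilla_right : readArray (M + 1) n (splice M (ancilla M y x T) s) = x := by
  funext i
  simp [readArray, mem_splice, mem_ancilla]

theorem writeArray_ancilla_left :
    writeArray M z (splice M (ancilla M y x T) s) = splice M (ancilla M z x T) s := by
  ext w
  simp only [mem_writeArray, mem_splice, mem_ancilla]
  grind

theorem writeArray_ancilla_right :
    writeArray (M + 1) z (splice M (ancilla M y x T) s) = splice M (ancilla M y z T) s := by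
  ext w
  simp only [mem_writeArray, mem_splice, mem_ancilla]
  grind

theorem runLin_descend_counterGate_ancilla (V : QMatrix n) (hM : 1 < M) {v : ℕ}
    (hT : ∀ i ∈ T, i < v) :
    runLin V (descend (counterGate (M + 2)) v) (ket (splice M (ancilla M y x T) s)) =
      ket (splice M (ancilla M y x (if (1, 0) ∈ s then counterStep T else T)) s) := by
  obtain ⟨s', hrun, hs'⟩ := runLin_descend_counterGate V (by omega : 1 < M + 2) v
    (splice M (ancilla M y x T) s)
  have hread (i : ℕ) : (M + 2, i) ∈ splice M (ancilla M y x T) s ↔ i ∈ T := by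
    simp [mem_splice, mem_ancilla]
  rw [hrun]
  refine congrArg ket (Finset.ext fun w => ?_)
  rw [hs', hread, mem_splice_of_lt (a := (1, 0)) hM]
  by_cases hctrl : ((1, 0) : Wire) ∈ s
  · simp only [hctrl, if_true, mem_splice, mem_ancilla, mem_counterStep]
    clear hs' hrun hread
    grind
  · simp [hctrl]

end Ancilla

/-- Apply an uncontrolled query to the oracle target if the control qubit `(1, 0)` is `1`, and to
the first `n` qubits of array `d` if it is `0`. -/
def redirect (d n : ℕ) (o : QueryOp) : Circuit :=
  [.not (1, 0)] ++ descend (ctrlSwap d) n ++ [.query (.uncontrolled o)] ++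
    descend (ctrlSwap d) n ++ [.not (1, 0)]

section Flip

variable {d n : ℕ} {a : Wire} (ha : a.1 ≠ d)

include ha

theorem readArray_flip (s : Finset Wire) : readArray d n (flip a s) = readArray d n s := by
  funext i
  have : ((d, (i : ℕ)) : Wire) ≠ a := fun h => ha (h ▸ rfl)
  simp [readArray, mem_flip, this]

theorem writeArray_flip (y : Fin n → Bool) (s : Finset Wire) :
    writeArray d y (flip a s) = flip a (writeArray d y s) := by
  ext w
  simp only [mem_writeArray, mem_flip]
  grind

theorem mem_writeArray_of_ne (y : Fin n → Bool) (s : Finset Wire) :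
    a ∈ writeArray d y s ↔ a ∈ s := by
  simp [mem_writeArray, ha]

end Flip

theorem runLin_redirect {n : ℕ} (V : QMatrix n) {d : ℕ} (hd : 1 < d) (o : QueryOp)
    (s : Finset Wire) :
    runLin V (redirect d n o) (ket s) =
      applyArray (if (1, 0) ∈ s then 0 else d) (o.apply V) s := by
  have hmap (s : Finset Wire) :
      ((1, 0) : Wire) ∈ s.map (arraySwap d n).toEmbedding ↔ ((1, 0) : Wire) ∈ s := by
    rw [mem_map_arraySwap, arraySwap_apply, Equiv.swap_apply_of_ne_of_ne one_ne_zero hd.ne,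
      ite_self]
  have h0 := readArray_flip (n := n) (a := (1, 0)) one_ne_zero
  have h0' := writeArray_flip (n := n) (a := (1, 0)) one_ne_zero
  simp only [redirect, runLin_append, runLin_singleton_ket, Gate.onBasis,
    runLin_descend_ctrlSwap V hd, mem_flip_self]
  by_cases hs : ((1, 0) : Wire) ∈ s
  · have hctrl (y : Fin n → Bool) : ((1, 0) : Wire) ∈ writeArray 0 y s :=
      (mem_writeArray_of_ne one_ne_zero y s).mpr hs
    rw [if_neg (not_not.mpr hs), if_pos hs]
    simp only [← applyArray_zero, applyArray, h0, h0', map_sum, map_smul,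
      runLin_singleton_ket, Gate.onBasis, runLin_descend_ctrlSwap V hd, mem_flip_self, hctrl,
      not_true, if_false, flip_flip]
  · have hctrl (y : Fin n → Bool) : ((1, 0) : Wire) ∉ writeArray d y s :=
      (mem_writeArray_of_ne hd.ne y s).not.mpr hs
    rw [if_pos hs, if_neg hs]
    simp only [runLin_singleton_ket, Gate.onBasis, applyTarget_map_arraySwap,
      readArray_flip (a := (1, 0)) hd.ne, writeArray_flip (a := (1, 0)) hd.ne, map_sum, map_smul,
      runLin_descend_ctrlSwap V hd, hmap, mem_flip_self, hctrl, not_false_eq_true,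
      if_true, map_arraySwap_map_arraySwap, flip_flip, applyArray]

/-- The number of counter steps for a controlled query whose control qubit is `1`. The
counter only goes up: a factor `φ⁻¹` is recorded, up to a common factor, by counting the other
branch. -/
def QueryOp.onShift : QueryOp → ℕ
  | plain | transpose => 1
  | adjoint | conj => 0

/-- The number of counter steps for a controlled query whose control qubit is `0`. -/
def QueryOp.offShift : QueryOp → ℕ
  | plain | transpose => 0
  | adjoint | conj => 1

/-- The half of the entangled pair on the arrays `M` and `M + 1` that is queried when the control
qubit is `0`. -/
def QueryOp.idleArray (M : ℕ) : QueryOp → ℕ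
  | plain | adjoint => M
  | conj | transpose => M + 1

/-- The counter steps that accompany a controlled query, for a counter with values below `v`. -/
def countQuery (M v : ℕ) : QueryOp → Circuit
  | .plain | .transpose => descend (counterGate (M + 2)) v
  | .adjoint | .conj => [.not (1, 0)] ++ descend (counterGate (M + 2)) v ++ [.not (1, 0)]

/-- Simulation of a controlled query, for a counter with values below `v`. -/
def gadget (M n v : ℕ) (o : QueryOp) : Circuit :=
  countQuery M v o ++ redirect (o.idleArray M) n o

theorem runLin_countQuery_ancilla {M n v : ℕ} (V : QMatrix n) (hM : 1 < M) (o : QueryOp)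
    (y x : Fin n → Bool) {T : Finset ℕ} (hT : ∀ i ∈ T, i < v) (s : Finset Wire) :
    runLin V (countQuery M v o) (ket (splice M (ancilla M y x T) s)) =
      ket (splice M (ancilla M y x
        (counterStep^[if (1, 0) ∈ s then o.onShift else o.offShift] T)) s) := by
  have hcount := runLin_descend_counterGate_ancilla y x T (V := V) (hM := hM) (hT := hT)
  have hflip := flip_splice (M := M) (a := (1, 0)) hM
  cases o <;> by_cases hs : ((1, 0) : Wire) ∈ s <;>
    simp only [countQuery, runLin_append, runLin_singleton_ket, Gate.onBasis, hflip, hcount,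
      mem_flip_self, hs, QueryOp.onShift, QueryOp.offShift, if_true, if_false, not_true,
      not_false_eq_true, flip_flip, Function.iterate_one, Function.iterate_zero, id]

/-- The state `∑ W_{yx} |y⟩|x⟩` on the arrays `M` and `M + 1`, with the counter `T`, next to a state
on the arrays below `M`. -/
def entangled (M : ℕ) {n : ℕ} (W : QMatrix n) (T : Finset ℕ) : State →ₗ[ℂ] State :=
  ∑ y, ∑ x, W y x • spliceLin M (ancilla M y x T)

theorem entangled_apply (M : ℕ) {n : ℕ} (W : QMatrix n) (T : Finset ℕ) (ψ : State) :
    entangled M W T ψ = ∑ y, ∑ x, W y x • spliceLin M (ancilla M y x T) ψ := by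
  simp only [entangled, LinearMap.sum_apply, LinearMap.smul_apply]

theorem extend_entangled {M n n' : ℕ} (V : QMatrix n') {g : Gate ℕ} (hg : g.ArraysLT M)
    (W : QMatrix n) (T : Finset ℕ) (ψ : State) :
    extend (g.onBasis V) (entangled M W T ψ) = entangled M W T (extend (g.onBasis V) ψ) := by
  simp only [entangled_apply, map_sum, map_smul, extend_spliceLin V hg]

theorem extend_applyArray_left_entangled {M n : ℕ} (A W : QMatrix n) (T : Finset ℕ) (ψ : State) :
    extend (applyArray M A) (entangled M W T ψ) = entangled M (A * W) T ψ := by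
  suffices extend (applyArray M A) ∘ₗ entangled M W T = entangled M (A * W) T from
    LinearMap.congr_fun this ψ
  refine hom_ext_ket fun s => ?_
  simp only [LinearMap.comp_apply, entangled_apply, map_sum, map_smul, spliceLin_ket, extend_ket,
    applyArray, readArray_ancilla_left, writeArray_ancilla_left, Matrix.mul_apply, Finset.smul_sum,
    Finset.sum_smul, smul_smul]
  rw [Finset.sum_comm, Finset.sum_congr rfl fun x _ => Finset.sum_comm, Finset.sum_comm]
  simp only [mul_comm]

theorem extend_applyArray_right_entangled {M n : ℕ} (A W : QMatrix n) (T : Finset ℕ) (ψ : State) :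
    extend (applyArray (M + 1) A) (entangled M W T ψ) = entangled M (W * A.transpose) T ψ := by
  suffices extend (applyArray (M + 1) A) ∘ₗ entangled M W T = entangled M (W * A.transpose) T from
    LinearMap.congr_fun this ψ
  refine hom_ext_ket fun s => ?_
  simp only [LinearMap.comp_apply, entangled_apply, map_sum, map_smul, spliceLin_ket, extend_ket,
    applyArray, readArray_ancilla_right, writeArray_ancilla_right, Matrix.mul_apply,
    Matrix.transpose_apply, Finset.smul_sum, Finset.sum_smul, smul_smul]
  exact Finset.sum_congr rfl fun y _ => Finset.sum_comm

theorem extend_idle_entangled_zpow {M n : ℕ} (V : QUnitary n) (o : QueryOp) (j : ℤ)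
    (T : Finset ℕ) (ψ : State) :
    extend (applyArray (o.idleArray M) (o.apply (V : QMatrix n)))
        (entangled M ((V ^ j : QUnitary n) : QMatrix n) T ψ) =
      entangled M ((V ^ (j + o.onShift - o.offShift) : QUnitary n) : QMatrix n) T ψ := by
  have hstar : (V : QMatrix n).conjTranspose = ((V⁻¹ : QUnitary n) : QMatrix n) := rfl
  have hconj : ((V : QMatrix n).map star).transpose = ((V⁻¹ : QUnitary n) : QMatrix n) := rfl
  cases o <;>
    simp only [QueryOp.idleArray, QueryOp.apply, QueryOp.onShift, QueryOp.offShift,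
      extend_applyArray_left_entangled, extend_applyArray_right_entangled,
      Matrix.transpose_transpose, hstar, hconj, ← Submonoid.coe_mul] <;>
    congr 3 <;> group

/-- The branch of a controlled application of `A` in which the control qubit is `1`. -/
def onBranch {n : ℕ} (A : QMatrix n) : State →ₗ[ℂ] State :=
  extend fun s => if (1, 0) ∈ s then applyTarget A s else 0

/-- The branch of a controlled query in which the control qubit is `0`. -/
def offBranch : State →ₗ[ℂ] State := extend fun s => if (1, 0) ∈ s then 0 else ket s

theorem extend_controlled {n : ℕ} (V : QMatrix n) (o : QueryOp) (ψ : State) :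
    extend ((Gate.query (.controlled o)).onBasis V) ψ =
      onBranch (o.apply V) ψ + offBranch ψ := by
  suffices extend ((Gate.query (.controlled o)).onBasis V) = onBranch (o.apply V) + offBranch from
    LinearMap.congr_fun this ψ
  refine hom_ext_ket fun s => ?_
  by_cases hs : ((1, 0) : Wire) ∈ s <;>
    simp [onBranch, offBranch, extend_ket, Gate.onBasis, hs]

theorem runLin_gadget_entangled {M n v : ℕ} (V : QMatrix n) (hM : 1 < M) (o : QueryOp)
    (W : QMatrix n) {T : Finset ℕ} (hT : ∀ i ∈ T, i < v) (ψ : State) :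
    runLin V (gadget M n v o) (entangled M W T ψ) =
      entangled M W (counterStep^[o.onShift] T) (onBranch (o.apply V) ψ) +
        extend (applyArray (o.idleArray M) (o.apply V))
          (entangled M W (counterStep^[o.offShift] T) (offBranch ψ)) := by
  have hidle : 1 < o.idleArray M := by cases o <;> simp only [QueryOp.idleArray] <;> omega
  suffices runLin V (gadget M n v o) ∘ₗ entangled M W T =
      entangled M W (counterStep^[o.onShift] T) ∘ₗ onBranch (o.apply V) +
        extend (applyArray (o.idleArray M) (o.apply V)) ∘ₗ
          entangled M W (counterStep^[o.offShift] T) ∘ₗ offBranch from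
    LinearMap.congr_fun this ψ
  refine hom_ext_ket fun s => ?_
  simp only [LinearMap.add_apply, LinearMap.comp_apply, onBranch, offBranch, extend_ket,
    entangled_apply, map_sum, map_smul, spliceLin_ket, gadget, runLin_append,
    runLin_countQuery_ancilla V hM o _ _ hT, runLin_redirect V hidle,
    mem_splice_of_lt (a := (1, 0)) hM]
  by_cases hs : ((1, 0) : Wire) ∈ s
  · simp only [hs, if_true, applyArray_splice (zero_lt_one.trans hM), applyArray_zero, map_zero,
      smul_zero, Finset.sum_const_zero, add_zero]
  · simp only [hs, if_false, map_zero, smul_zero, Finset.sum_const_zero, zero_add, spliceLin_ket,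
      extend_ket]

theorem runLin_gadget_entangled_zpow {M n v : ℕ} (V : QUnitary n) (hM : 1 < M) (o : QueryOp)
    (j : ℤ) {T : Finset ℕ} (hT : ∀ i ∈ T, i < v) (ψ : State) :
    runLin (V : QMatrix n) (gadget M n v o)
        (entangled M ((V ^ j : QUnitary n) : QMatrix n) T ψ) =
      entangled M ((V ^ j : QUnitary n) : QMatrix n) (counterStep^[o.onShift] T)
          (onBranch (o.apply (V : QMatrix n)) ψ) +
        entangled M ((V ^ (j + o.onShift - o.offShift) : QUnitary n) : QMatrix n)
          (counterStep^[o.offShift] T) (offBranch ψ) := by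
  rw [runLin_gadget_entangled _ hM o _ hT, extend_idle_entangled_zpow]

/-! ## Preparation of the ancilla registers -/

/-- Preparation of an entangled pair of qubits. -/
def entangle (M i : ℕ) : Circuit := [.hadamard (M, i), .cnot (M, i) (M + 1, i)]

/-- Preparation of the counter and of a maximally entangled pair of registers. -/
def prepare (M n : ℕ) : Circuit := [.not (M + 2, 0)] ++ descend (entangle M) n

theorem runLin_entangle {n : ℕ} (W : QMatrix n) {M v : ℕ} {s : Finset Wire} (h : (M, v) ∉ s)
    (h' : (M + 1, v) ∉ s) :
    runLin W (entangle M v) (ket s) =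
      ((1 / Real.sqrt 2 : ℝ) : ℂ) • (ket s + ket (s ∪ {(M, v), (M + 1, v)})) := by
  have hne : ((M, v) : Wire) ≠ (M + 1, v) := by simp
  have hflip : flip (M + 1, v) (insert (M, v) s) = s ∪ {(M, v), (M + 1, v)} := by
    ext w
    simp only [mem_flip, Finset.mem_insert, Finset.mem_union, Finset.mem_singleton]
    grind
  rw [entangle, runLin_cons, extend_ket, Gate.onBasis, if_neg h, one_smul,
    Finset.erase_eq_of_notMem h, map_smul, map_add, runLin_singleton_ket, runLin_singleton_ket,
    onBasis_cnot W hne, onBasis_cnot W hne, if_neg h, if_pos (Finset.mem_insert_self _ _), hflip]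

theorem block_snoc {v : ℕ} (a : ℕ) (x : Fin v → Bool) (b : Bool) :
    block a (Fin.snoc x b : Fin (v + 1) → Bool) = block a x ∪ if b then {(a, v)} else ∅ := by
  ext ⟨c, i⟩
  simp only [Finset.mem_union, mem_block]
  rcases lt_trichotomy i v with h | rfl | h
  · cases b <;> simp [Fin.snoc, h, h.ne, h.trans (Nat.lt_succ_self v)]
  · cases b <;> simp [Fin.snoc]
  · have : ¬ i ≤ v := h.not_ge
    cases b <;> simp [h.ne', h.not_gt, this]

theorem runLin_descend_entangle {n : ℕ} (W : QMatrix n) {M v : ℕ} {s : Finset Wire}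
    (h : ∀ i < v, (M, i) ∉ s ∧ (M + 1, i) ∉ s) :
    runLin W (descend (entangle M) v) (ket s) =
      ((1 / Real.sqrt 2 : ℝ) : ℂ) ^ v •
        ∑ x : Fin v → Bool, ket (s ∪ (block M x ∪ block (M + 1) x)) := by
  induction v generalizing s with
  | zero =>
    have (a : ℕ) (x : Fin 0 → Bool) : block a x = ∅ := rfl
    simp [descend, runLin, this]
  | succ v ih =>
    have hunion : ∀ i < v, (M, i) ∉ s ∪ {(M, v), (M + 1, v)} ∧
        (M + 1, i) ∉ s ∪ {(M, v), (M + 1, v)} := by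
      intro i hi
      simp [h i (hi.trans (Nat.lt_succ_self v)), hi.ne]
    have hassoc (x : Fin v → Bool) :
        s ∪ {(M, v), (M + 1, v)} ∪ (block M x ∪ block (M + 1) x) =
          s ∪ (block M x ∪ {(M, v)} ∪ (block (M + 1) x ∪ {(M + 1, v)})) := by
      ext w
      simp only [Finset.mem_union, Finset.mem_insert, Finset.mem_singleton]
      tauto
    rw [descend, runLin_append, runLin_entangle W (h v v.lt_succ_self).1 (h v v.lt_succ_self).2,
      add_comm (ket s), map_smul, map_add, ih hunion,
      ih fun i hi => h i (hi.trans (Nat.lt_succ_self v)),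
      ← smul_add, smul_smul, ← pow_succ', ← Equiv.sum_comp (Fin.snocEquiv fun _ => Bool),
      Fintype.sum_prod_type, Fintype.sum_bool]
    simp only [Fin.snocEquiv, Equiv.coe_fn_mk, block_snoc, if_true, if_false, Bool.false_eq_true,
      Finset.union_empty, hassoc]

theorem runLin_prepare {n : ℕ} (W : QMatrix n) (M : ℕ) :
    runLin W (prepare M n) (ket ∅) =
      ((1 / Real.sqrt 2 : ℝ) : ℂ) ^ n • entangled M (1 : QMatrix n) {0} (ket ∅) := by
  have hflip : flip (M + 2, 0) ∅ = {(M + 2, 0)} := by simp [flip]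
  have hspl (x : Fin n → Bool) : {(M + 2, 0)} ∪ (block M x ∪ block (M + 1) x) =
      splice M (ancilla M x x {0}) ∅ := by
    ext w
    simp only [mem_splice, mem_ancilla, Finset.mem_union, mem_block, Finset.mem_singleton]
    grind
  rw [prepare, runLin_append, runLin_singleton_ket, Gate.onBasis, hflip,
    runLin_descend_entangle W (by simp)]
  simp only [hspl, entangled_apply, spliceLin_ket, Matrix.one_apply, ite_smul, one_smul, zero_smul,
    Finset.sum_ite_eq, Finset.mem_univ, if_true]

/-! ## Expansion in powers of the phase -/

/-- The number of controlled queries that a gate makes. -/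
def Gate.controlledCount {ι : Type} : Gate ι → ℕ
  | .query (.controlled _) => 1
  | _ => 0

/-- The `QueryOp.onShift` of a controlled query; other gates do not move the counter. -/
def Gate.onShift : Gate ℕ → ℕ
  | .query (.controlled o) => o.onShift
  | _ => 0

/-- The `QueryOp.offShift` of a controlled query; other gates do not move the counter. -/
def Gate.offShift : Gate ℕ → ℕ
  | .query (.controlled o) => o.offShift
  | _ => 0

/-- A controlled query is replaced by a gadget for a counter with values below `v`. -/
def Gate.simulate (M n v : ℕ) : Gate ℕ → Circuit
  | .query (.controlled o) => gadget M n v o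
  | g => [g]

/-- Replacement of all controlled queries by gadgets. The counter has values below `v` at first. -/
def simulate (M n : ℕ) : ℕ → Circuit → Circuit
  | _, [] => []
  | v, g :: c => g.simulate M n v ++ simulate M n (v + g.controlledCount) c

/-- The number of controlled queries of a circuit. -/
def controlledCount (c : Circuit) : ℕ := (c.map Gate.controlledCount).sum

/-- The action of a gate on the coefficients of powers of `φ`, when the oracle is `φ • V`. A common
factor `φ ^ (- g.offShift)` is left out, so that no negative powers occur. -/
def expandGate {n : ℕ} (V : QMatrix n) : Gate ℕ → (ℕ →₀ State) →ₗ[ℂ] (ℕ →₀ State)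
  | .query (.controlled o) => Finsupp.lsum ℂ fun k =>
      Finsupp.lsingle (k + o.onShift) ∘ₗ onBranch (o.apply V) +
        Finsupp.lsingle (k + o.offShift) ∘ₗ offBranch
  | g => Finsupp.mapRange.linearMap (extend (g.onBasis V))

/-- The value at `φ` of the Laurent polynomial with the coefficient of `φ ^ (k - m)` given by
`A k`. -/
def evalPhase (φ : ℂ) (m : ℕ) : (ℕ →₀ State) →ₗ[ℂ] State :=
  Finsupp.lsum ℂ fun k => φ ^ ((k : ℤ) - m) • LinearMap.id

/-- The superposition of the states `A k` next to the counter `k` and the entangled state of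
`V ^ (N - k)`. -/
def evalEntangled (M : ℕ) {n : ℕ} (V : QUnitary n) (N : ℕ) : (ℕ →₀ State) →ₗ[ℂ] State :=
  Finsupp.lsum ℂ fun k => entangled M ((V ^ ((N : ℤ) - k) : QUnitary n) : QMatrix n) (counter k)

theorem evalPhase_single (φ : ℂ) (m k : ℕ) (ψ : State) :
    evalPhase φ m (Finsupp.single k ψ) = φ ^ ((k : ℤ) - m) • ψ := by
  simp [evalPhase]

theorem evalEntangled_single (M : ℕ) {n : ℕ} (V : QUnitary n) (N k : ℕ) (ψ : State) :
    evalEntangled M V N (Finsupp.single k ψ) =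
      entangled M ((V ^ ((N : ℤ) - k) : QUnitary n) : QMatrix n) (counter k) ψ := by
  simp [evalEntangled]

theorem expandGate_controlled_single {n : ℕ} (V : QMatrix n) (o : QueryOp) (k : ℕ) (ψ : State) :
    expandGate V (.query (.controlled o)) (Finsupp.single k ψ) =
      Finsupp.single (k + o.onShift) (onBranch (o.apply V) ψ) +
        Finsupp.single (k + o.offShift) (offBranch ψ) := by
  simp [expandGate]

theorem expandGate_single_of_ne {n : ℕ} (V : QMatrix n) {g : Gate ℕ}
    (hg : ∀ o, g ≠ .query (.controlled o)) (k : ℕ) (ψ : State) :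
    expandGate V g (Finsupp.single k ψ) = Finsupp.single k (extend (g.onBasis V) ψ) := by
  unfold expandGate
  split
  · exact absurd rfl (hg _)
  · simp

theorem onBranch_smul {n : ℕ} (a : ℂ) (A : QMatrix n) (ψ : State) :
    onBranch (a • A) ψ = a • onBranch A ψ := by
  suffices onBranch (a • A) = a • onBranch A from LinearMap.congr_fun this ψ
  refine hom_ext_ket fun s => ?_
  by_cases hs : ((1, 0) : Wire) ∈ s <;>
    simp [onBranch, extend_ket, hs, applyTarget, Finset.smul_sum, smul_smul]

theorem QueryOp.apply_smul {n : ℕ} {φ : ℂ} (hφ : ‖φ‖ = 1) (V : QMatrix n) (o : QueryOp) :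
    o.apply (φ • V) = φ ^ ((o.onShift : ℤ) - o.offShift) • o.apply V := by
  have hstar : star φ = φ⁻¹ := (Complex.inv_eq_conj hφ).symm
  cases o <;> ext i j <;> simp [QueryOp.apply, QueryOp.onShift, QueryOp.offShift, ← hstar]

theorem extend_evalPhase {n : ℕ} {S : Set QueryOp} {φ : ℂ} (hφ : ‖φ‖ = 1) (V : QMatrix n)
    {g : Gate ℕ} (hg : g.Allowed (Query.controlled '' S)) (m : ℕ) (A : ℕ →₀ State) :
    extend (g.onBasis (φ • V)) (evalPhase φ m A) =
      evalPhase φ (m + g.offShift) (expandGate V g A) := by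
  have hφ0 : φ ≠ 0 := norm_ne_zero_iff.mp (hφ ▸ one_ne_zero)
  suffices extend (g.onBasis (φ • V)) ∘ₗ evalPhase φ m =
      evalPhase φ (m + g.offShift) ∘ₗ expandGate V g from LinearMap.congr_fun this A
  refine Finsupp.lhom_ext fun k ψ => ?_
  simp only [LinearMap.comp_apply, evalPhase_single, map_smul]
  by_cases h : ∃ o, g = .query (.controlled o)
  · obtain ⟨o, rfl⟩ := h
    rw [expandGate_controlled_single, map_add, evalPhase_single, evalPhase_single,
      extend_controlled, QueryOp.apply_smul hφ, onBranch_smul, smul_add, smul_smul,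
      ← zpow_add₀ hφ0, Gate.offShift]
    congr 3 <;> push_cast <;> ring
  · push Not at h
    rw [expandGate_single_of_ne V h, evalPhase_single]
    cases g with
    | query q =>
      obtain ⟨o, -, rfl⟩ := hg
      exact absurd rfl (h o)
    | _ => rfl

theorem runLin_simulate_evalEntangled {M n v : ℕ} (V : QUnitary n) (hM : 1 < M) {g : Gate ℕ}
    (hg : g.ArraysLT M) (N : ℕ) {A : ℕ →₀ State} (hA : A ∈ Finsupp.supported State ℂ (Set.Iio v)) :
    runLin (V : QMatrix n) (g.simulate M n v) (evalEntangled M V N A) =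
      evalEntangled M V (N + g.onShift) (expandGate (V : QMatrix n) g A) := by
  rw [← Finsupp.sum_single A, Finsupp.sum]
  simp only [map_sum]
  refine Finset.sum_congr rfl fun k hk => ?_
  have hkv : ∀ i ∈ counter k, i < v := fun i hi => ((isGreatest_counter k).2 hi).trans_lt (hA hk)
  rw [evalEntangled_single]
  by_cases h : ∃ o, g = .query (.controlled o)
  · obtain ⟨o, rfl⟩ := h
    have hon : ((N + o.onShift : ℕ) : ℤ) - (k + o.onShift : ℕ) = N - k := by push_cast; ring
    have hoff : ((N + o.onShift : ℕ) : ℤ) - (k + o.offShift : ℕ) =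
        N - k + o.onShift - o.offShift := by push_cast; ring
    rw [expandGate_controlled_single, map_add, evalEntangled_single, evalEntangled_single,
      Gate.simulate, runLin_gadget_entangled_zpow V hM o _ hkv, ← counter_add, ← counter_add,
      Gate.onShift, hon, hoff]
  · push Not at h
    rw [expandGate_single_of_ne _ h, evalEntangled_single]
    have hrun : g.simulate M n v = [g] ∧ g.onShift = 0 := by
      unfold Gate.simulate Gate.onShift
      split
      · exact absurd rfl (h _)
      · exact ⟨rfl, rfl⟩
    rw [hrun.1, hrun.2, runLin_cons, extend_entangled _ hg]
    rfl

theorem expandGate_mem_supported {n v : ℕ} (V : QMatrix n) (g : Gate ℕ) {A : ℕ →₀ State}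
    (hA : A ∈ Finsupp.supported State ℂ (Set.Iio v)) :
    expandGate V g A ∈ Finsupp.supported State ℂ (Set.Iio (v + g.controlledCount)) := by
  rw [← Finsupp.sum_single A, Finsupp.sum, map_sum]
  refine Submodule.sum_mem _ fun k hk => ?_
  have hkv : k < v := hA hk
  by_cases h : ∃ o, g = .query (.controlled o)
  · obtain ⟨o, rfl⟩ := h
    rw [expandGate_controlled_single]
    refine Submodule.add_mem _ (Finsupp.single_mem_supported _ _ ?_)
      (Finsupp.single_mem_supported _ _ ?_) <;>
      cases o <;> simp only [Set.mem_Iio, QueryOp.onShift, QueryOp.offShift,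
        Gate.controlledCount] <;> omega
  · push Not at h
    rw [expandGate_single_of_ne V h]
    exact Finsupp.single_mem_supported _ _ (hkv.trans_le (Nat.le_add_right _ _))

theorem onBranch_spliceLin {M n : ℕ} (hM : 1 < M) (A : QMatrix n) (R : Finset Wire) (ψ : State) :
    onBranch A (spliceLin M R ψ) = spliceLin M R (onBranch A ψ) := by
  suffices onBranch A ∘ₗ spliceLin M R = spliceLin M R ∘ₗ onBranch A from
    LinearMap.congr_fun this ψ
  refine hom_ext_ket fun s => ?_
  simp only [LinearMap.comp_apply, onBranch, spliceLin_ket, extend_ket,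
    mem_splice_of_lt (a := (1, 0)) hM, ← applyArray_zero, applyArray_splice (zero_lt_one.trans hM)]
  split_ifs <;> simp

theorem offBranch_spliceLin {M : ℕ} (hM : 1 < M) (R : Finset Wire) (ψ : State) :
    offBranch (spliceLin M R ψ) = spliceLin M R (offBranch ψ) := by
  suffices offBranch ∘ₗ spliceLin M R = spliceLin M R ∘ₗ offBranch from
    LinearMap.congr_fun this ψ
  refine hom_ext_ket fun s => ?_
  simp only [LinearMap.comp_apply, offBranch, spliceLin_ket, extend_ket,
    mem_splice_of_lt (a := (1, 0)) hM]
  split_ifs <;> simp [spliceLin_ket]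

theorem expandGate_mapRange_spliceLin {M n : ℕ} (hM : 1 < M) (V : QMatrix n) {g : Gate ℕ}
    (hg : g.ArraysLT M) (R : Finset Wire) (A : ℕ →₀ State) :
    expandGate V g (Finsupp.mapRange.linearMap (spliceLin M R) A) =
      Finsupp.mapRange.linearMap (spliceLin M R) (expandGate V g A) := by
  suffices expandGate V g ∘ₗ Finsupp.mapRange.linearMap (spliceLin M R) =
      Finsupp.mapRange.linearMap (spliceLin M R) ∘ₗ expandGate V g from LinearMap.congr_fun this A
  refine Finsupp.lhom_ext fun k ψ => ?_
  simp only [LinearMap.comp_apply, Finsupp.mapRange.linearMap_apply, Finsupp.mapRange_single]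
  by_cases h : ∃ o, g = .query (.controlled o)
  · obtain ⟨o, rfl⟩ := h
    simp only [expandGate_controlled_single, ← Finsupp.mapRange.linearMap_apply, map_add]
    simp only [Finsupp.mapRange.linearMap_apply, Finsupp.mapRange_single,
      onBranch_spliceLin hM, offBranch_spliceLin hM]
  · push Not at h
    simp only [expandGate_single_of_ne V h, Finsupp.mapRange_single, extend_spliceLin V hg]

/-- A circuit on `φ • V` and its simulation on `V` have expansions with the same coefficients. -/
theorem exists_phaseExpansion {M n v : ℕ} {S : Set QueryOp} (V : QUnitary n) (hM : 1 < M)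
    {c : Circuit} (hc : c.Allowed (Query.controlled '' S)) (hcM : ∀ g ∈ c, g.ArraysLT M) (m N : ℕ)
    {A : ℕ →₀ State} (hA : A ∈ Finsupp.supported State ℂ (Set.Iio v))
    (hmain : Finsupp.mapRange.linearMap (spliceLin M ∅) A = A) :
    ∃ (m' N' : ℕ) (B : ℕ →₀ State),
      B ∈ Finsupp.supported State ℂ (Set.Iio (v + controlledCount c)) ∧
      Finsupp.mapRange.linearMap (spliceLin M ∅) B = B ∧
      (∀ φ : ℂ, ‖φ‖ = 1 →
        runLin (φ • (V : QMatrix n)) c (evalPhase φ m A) = evalPhase φ m' B) ∧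
      runLin (V : QMatrix n) (simulate M n v c) (evalEntangled M V N A) =
        evalEntangled M V N' B := by
  induction c generalizing v m N A with
  | nil => exact ⟨m, N, A, hA, hmain, fun _ _ => rfl, rfl⟩
  | cons g c ih =>
    obtain ⟨hg, hc⟩ := List.forall_mem_cons.mp hc
    obtain ⟨hgM, hcM⟩ := List.forall_mem_cons.mp hcM
    obtain ⟨m', N', B, hB, hBmain, hphase, hsim⟩ := ih hc hcM (m + g.offShift) (N + g.onShift)
      (expandGate_mem_supported (V : QMatrix n) g hA)
      (by rw [← expandGate_mapRange_spliceLin hM _ hgM, hmain])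
    refine ⟨m', N', B, ?_, hBmain, fun φ hφ => ?_, ?_⟩
    · rwa [controlledCount, List.map_cons, List.sum_cons, ← add_assoc]
    · rw [runLin_cons, extend_evalPhase hφ _ hg, hphase φ hφ]
    · rw [simulate, runLin_append, runLin_simulate_evalEntangled V hM hgM N hA, hsim]

/-! ## Averaging over roots of unity -/

theorem rootPhase_eq_pow (n : ℕ) (x : Fin (2 ^ n)) :
    rootPhase n x = Complex.exp (2 * Real.pi * Complex.I / (2 ^ n : ℕ)) ^ (x : ℕ) := by
  rw [rootPhase, ← Complex.exp_nat_mul]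
  congr 1
  push_cast
  ring

theorem norm_rootPhase (n : ℕ) (x : Fin (2 ^ n)) : ‖rootPhase n x‖ = 1 := by
  rw [rootPhase_eq_pow, norm_pow,
    (Complex.isPrimitiveRoot_exp (2 ^ n) (by positivity)).norm'_eq_one (by positivity), one_pow]

theorem sum_rootPhase_zpow (n : ℕ) (j : ℤ) :
    ∑ x : Fin (2 ^ n), rootPhase n x ^ j = if (2 ^ n : ℤ) ∣ j then 2 ^ n else 0 := by
  have hprim := Complex.isPrimitiveRoot_exp (2 ^ n) (by positivity)
  set ω := Complex.exp (2 * Real.pi * Complex.I / (2 ^ n : ℕ)) with hω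
  have hdvd : ω ^ j = 1 ↔ (2 ^ n : ℤ) ∣ j := by
    rw [hprim.zpow_eq_one_iff_dvd]
    push_cast
    rfl
  have hterm (x : Fin (2 ^ n)) : rootPhase n x ^ j = (ω ^ j) ^ (x : ℕ) := by
    rw [rootPhase_eq_pow, ← hω, ← zpow_natCast, ← zpow_natCast, zpow_comm]
  simp only [hterm, Fin.sum_univ_eq_sum_range (fun i => (ω ^ j) ^ i)]
  split_ifs with h
  · simp [hdvd.mpr h]
  · have hgeom := geom_sum_mul (ω ^ j) (2 ^ n)
    rw [← zpow_natCast, zpow_comm, zpow_natCast, hprim.pow_eq_one, one_zpow, sub_self] at hgeom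
    exact (mul_eq_zero.mp hgeom).resolve_right (sub_ne_zero.mpr fun h1 => h (hdvd.mp h1))

theorem ofReal_norm_sq (z : ℂ) : ((‖z‖ ^ 2 : ℝ) : ℂ) = z * star z := by
  rw [Complex.ofReal_pow]
  exact (Complex.mul_conj' z).symm

theorem sum_norm_sq_rootPhase {n : ℕ} {I : Finset ℕ} (hI : ∀ k ∈ I, k < 2 ^ n) (m : ℕ)
    (b : ℕ → ℂ) :
    ∑ x : Fin (2 ^ n), ‖∑ k ∈ I, rootPhase n x ^ ((k : ℤ) - m) * b k‖ ^ 2 =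
      2 ^ n * ∑ k ∈ I, ‖b k‖ ^ 2 := by
  have hcross (x : Fin (2 ^ n)) (k l : ℕ) :
      rootPhase n x ^ ((k : ℤ) - m) * b k * star (rootPhase n x ^ ((l : ℤ) - m) * b l) =
        rootPhase n x ^ ((k : ℤ) - l) * (b k * star (b l)) := by
    have h0 : rootPhase n x ≠ 0 := norm_ne_zero_iff.mp (norm_rootPhase n x ▸ one_ne_zero)
    have hstar : star (rootPhase n x) = (rootPhase n x)⁻¹ :=
      (Complex.inv_eq_conj (norm_rootPhase n x)).symm
    rw [star_mul', star_zpow₀, hstar, inv_zpow', mul_mul_mul_comm, ← zpow_add₀ h0]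
    congr 2
    ring
  have hdiag {k l : ℕ} (hk : k ∈ I) (hl : l ∈ I) : (2 ^ n : ℤ) ∣ (k : ℤ) - l ↔ k = l := by
    refine ⟨fun h => ?_, fun h => by simp [h]⟩
    have habs : |(k : ℤ) - l| < 2 ^ n := by
      have hk' : (k : ℤ) < 2 ^ n := mod_cast hI k hk
      have hl' : (l : ℤ) < 2 ^ n := mod_cast hI l hl
      exact abs_sub_lt_of_nonneg_of_lt (by positivity) hk' (by positivity) hl'
    exact_mod_cast sub_eq_zero.mp (Int.eq_zero_of_abs_lt_dvd h habs)
  refine Complex.ofReal_injective ?_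
  rw [Complex.ofReal_sum, Complex.ofReal_mul, Complex.ofReal_sum]
  simp only [ofReal_norm_sq, star_sum, Finset.sum_mul_sum, hcross]
  rw [Finset.sum_comm, Finset.mul_sum]
  refine Finset.sum_congr rfl fun k hk => ?_
  rw [Finset.sum_comm]
  simp only [← Finset.sum_mul, sum_rootPhase_zpow]
  rw [Finset.sum_congr rfl fun l hl => by rw [if_congr (hdiag hk hl) rfl rfl],
    Finset.sum_eq_single k]
  · simp
  · simp +contextual [eq_comm]
  · exact fun h => absurd hk h

theorem normSq_eq_sum {ψ : State} {F : Finset (Finset Wire)} (h : ψ.support ⊆ F) :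
    normSq ψ = ∑ s ∈ F, ‖ψ s‖ ^ 2 :=
  Finsupp.sum_of_support_subset _ h _ (by simp)

theorem sum_normSq_evalPhase {n : ℕ} (m : ℕ) {A : ℕ →₀ State}
    (hA : A ∈ Finsupp.supported State ℂ (Set.Iio (2 ^ n))) :
    ∑ x : Fin (2 ^ n), normSq (evalPhase (rootPhase n x) m A) =
      2 ^ n * A.sum fun _ ψ => normSq ψ := by
  classical
  set F := A.support.biUnion fun k => (A k).support
  have hAF (k : ℕ) (hk : k ∈ A.support) : (A k).support ⊆ F :=
    Finset.subset_biUnion_of_mem (fun k => (A k).support) hk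
  have hcoord (φ : ℂ) (s : Finset Wire) :
      evalPhase φ m A s = ∑ k ∈ A.support, φ ^ ((k : ℤ) - m) * A k s := by
    simp [evalPhase, Finsupp.sum, Finsupp.finsetSum_apply]
  have hsupp (φ : ℂ) : (evalPhase φ m A).support ⊆ F := fun s hs => by
    rw [Finsupp.mem_support_iff, hcoord] at hs
    obtain ⟨k, hk, hks⟩ := Finset.exists_ne_zero_of_sum_ne_zero hs
    exact hAF k hk (Finsupp.mem_support_iff.mpr (right_ne_zero_of_mul hks))
  simp only [normSq_eq_sum (hsupp _), hcoord, Finsupp.sum]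
  rw [Finset.sum_comm, Finset.sum_congr rfl fun k hk => normSq_eq_sum (hAF k hk),
    Finset.sum_comm (s := A.support), Finset.mul_sum]
  exact Finset.sum_congr rfl fun s _ => sum_norm_sq_rootPhase (fun k hk => hA hk) m _

/-! ## Orthogonality of the branches -/

theorem normSq_smul (a : ℂ) (ψ : State) : normSq (a • ψ) = ‖a‖ ^ 2 * normSq ψ := by
  rw [normSq_eq_sum (Finsupp.support_smul), normSq_eq_sum subset_rfl, Finset.mul_sum]
  simp only [Finsupp.smul_apply, smul_eq_mul, norm_mul, mul_pow]

theorem normSq_sum {ι : Type*} (I : Finset ι) (Ψ : ι → State)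
    (h : ∀ i ∈ I, ∀ j ∈ I, i ≠ j → Disjoint (Ψ i).support (Ψ j).support) :
    normSq (∑ i ∈ I, Ψ i) = ∑ i ∈ I, normSq (Ψ i) := by
  classical
  induction I using Finset.induction_on with
  | empty => simp [normSq]
  | insert i I hi ih =>
    have hdisj : Disjoint (Ψ i).support (∑ j ∈ I, Ψ j).support := by
      refine .mono_right Finsupp.support_finsetSum
        ((Finset.disjoint_biUnion_right _ _ _).mpr fun j hj => ?_)
      exact h i (Finset.mem_insert_self i I) j (Finset.mem_insert_of_mem hj)
        (ne_of_mem_of_not_mem hj hi).symm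
    rw [Finset.sum_insert hi, Finset.sum_insert hi, ← ih fun j hj k hk =>
      h j (Finset.mem_insert_of_mem hj) k (Finset.mem_insert_of_mem hk)]
    exact Finsupp.sum_add_index_of_disjoint hdisj _

theorem exists_eq_splice {M : ℕ} {R s : Finset Wire} {ψ : State}
    (hs : s ∈ (spliceLin M R ψ).support) : ∃ s', s = splice M R s' := by
  obtain ⟨s', -, rfl⟩ := Finset.mem_image.mp (Finsupp.mapDomain_support hs)
  exact ⟨s', rfl⟩

theorem normSq_spliceLin {M : ℕ} (R : Finset Wire) {ψ : State} (hψ : spliceLin M ∅ ψ = ψ) :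
    normSq (spliceLin M R ψ) = normSq ψ := by
  have hinj : Set.InjOn (splice M R) ψ.support := fun s hs t ht hst => by
    rw [← hψ] at hs ht
    obtain ⟨s, rfl⟩ := exists_eq_splice hs
    obtain ⟨t, rfl⟩ := exists_eq_splice ht
    simpa only [splice_splice] using congrArg (splice M ∅) hst
  rw [normSq, Finsupp.sum, spliceLin, Finsupp.lmapDomain_apply,
    Finsupp.mapDomain_support_of_injOn ψ hinj, Finset.sum_image hinj]
  exact Finset.sum_congr rfl fun s hs => by rw [Finsupp.mapDomain_apply' _ ψ subset_rfl hinj hs]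

theorem disjoint_support_spliceLin {M : ℕ} {R R' : Finset Wire} {w : Wire} (hw : M ≤ w.1)
    (hR : ¬ (w ∈ R ↔ w ∈ R')) (ψ ψ' : State) :
    Disjoint (spliceLin M R ψ).support (spliceLin M R' ψ').support := by
  refine Finset.disjoint_left.mpr fun s hs hs' => hR ?_
  obtain ⟨t, ht⟩ := exists_eq_splice hs
  obtain ⟨t', rfl⟩ := exists_eq_splice hs'
  simpa only [mem_splice, hw.not_gt, if_false] using (Finset.ext_iff.mp ht w).symm

theorem exists_mem_ancilla_of_ne {M n : ℕ} {y y' x x' : Fin n → Bool} {T T' : Finset ℕ}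
    (h : (T, y, x) ≠ (T', y', x')) :
    ∃ w : Wire, M ≤ w.1 ∧ ¬ (w ∈ ancilla M y x T ↔ w ∈ ancilla M y' x' T') := by
  contrapose! h
  have hT : T = T' := by
    ext i
    simpa [mem_ancilla] using h (M + 2, i)
  have hy : y = y' := by
    ext i
    simpa [mem_ancilla] using h (M, i)
  have hx : x = x' := by
    ext i
    simpa [mem_ancilla] using h (M + 1, i)
  rw [hT, hy, hx]

theorem sum_norm_sq_unitary {n : ℕ} (V : QUnitary n) :
    ∑ y, ∑ x, ‖(V : QMatrix n) y x‖ ^ 2 = 2 ^ n := by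
  have hrow (y) : ∑ x, ‖(V : QMatrix n) y x‖ ^ 2 = 1 := by
    refine Complex.ofReal_injective ?_
    rw [Complex.ofReal_sum, Complex.ofReal_one, ← Matrix.one_apply_eq (α := ℂ) y,
      ← Matrix.mem_unitaryGroup_iff.mp V.2, Matrix.mul_apply]
    simp only [ofReal_norm_sq, Matrix.star_apply]
  simp [hrow]

theorem normSq_evalEntangled {M n : ℕ} (V : QUnitary n) (N : ℕ) {A : ℕ →₀ State}
    (hA : ∀ k, spliceLin M ∅ (A k) = A k) :
    normSq (evalEntangled M V N A) = 2 ^ n * A.sum fun _ ψ => normSq ψ := by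
  let W (k : ℕ) : QMatrix n := (V ^ ((N : ℤ) - k) : QUnitary n)
  have hexpand : evalEntangled M V N A =
      ∑ i ∈ A.support ×ˢ (Finset.univ : Finset ((Fin n → Bool) × (Fin n → Bool))),
        W i.1 i.2.1 i.2.2 • spliceLin M (ancilla M i.2.1 i.2.2 (counter i.1)) (A i.1) := by
    rw [Finset.sum_product]
    simp only [Fintype.sum_prod_type, ← entangled_apply]
    rfl
  rw [hexpand, normSq_sum, Finset.sum_product, Finsupp.sum, Finset.mul_sum]
  · refine Finset.sum_congr rfl fun k _ => ?_
    simp only [normSq_smul, normSq_spliceLin _ (hA k), ← Finset.sum_mul, Fintype.sum_prod_type]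
    rw [sum_norm_sq_unitary]
  · rintro ⟨k, y, x⟩ - ⟨k', y', x'⟩ - hne
    obtain ⟨w, hw, hmem⟩ := exists_mem_ancilla_of_ne (M := M)
      (h := fun h : (counter k, y, x) = (counter k', y', x') => hne <| by
        rw [Prod.mk.injEq] at h ⊢
        exact h.imp_left fun h => counter_injective h)
    exact (disjoint_support_spliceLin hw hmem _ _).mono Finsupp.support_smul Finsupp.support_smul

/-! ## Acceptance -/

/-- The part of a state on which the output qubit is `1`. -/
def acceptBranch : State →ₗ[ℂ] State := extend fun s => if (2, 0) ∈ s then ket s else 0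

theorem acceptBranch_eq_filter (ψ : State) :
    acceptBranch ψ = ψ.filter fun s => ((2, 0) : Wire) ∈ s := by
  induction ψ using Finsupp.induction_linear with
  | zero => rw [map_zero, Finsupp.filter_zero]
  | add ψ χ hψ hχ => rw [map_add, hψ, hχ, Finsupp.filter_add]
  | single s a =>
    by_cases hs : ((2, 0) : Wire) ∈ s <;>
      simp [acceptBranch, extend, ket, hs]

theorem acceptProb_eq {n : ℕ} (V : QMatrix n) (c : Circuit) :
    acceptProb V c = normSq (acceptBranch (runLin V c (ket ∅))) := by
  rw [acceptProb, runCircuit_eq_runLin, acceptBranch_eq_filter]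

theorem acceptBranch_spliceLin {M : ℕ} (hM : 2 < M) (R : Finset Wire) (ψ : State) :
    acceptBranch (spliceLin M R ψ) = spliceLin M R (acceptBranch ψ) := by
  suffices acceptBranch ∘ₗ spliceLin M R = spliceLin M R ∘ₗ acceptBranch from
    LinearMap.congr_fun this ψ
  refine hom_ext_ket fun s => ?_
  simp only [LinearMap.comp_apply, acceptBranch, spliceLin_ket, extend_ket,
    mem_splice_of_lt (a := (2, 0)) hM]
  split_ifs <;> simp [spliceLin_ket]

theorem acceptBranch_evalPhase (φ : ℂ) (m : ℕ) (A : ℕ →₀ State) :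
    acceptBranch (evalPhase φ m A) =
      evalPhase φ m (Finsupp.mapRange.linearMap acceptBranch A) := by
  suffices acceptBranch ∘ₗ evalPhase φ m =
      evalPhase φ m ∘ₗ Finsupp.mapRange.linearMap acceptBranch from LinearMap.congr_fun this A
  exact Finsupp.lhom_ext fun k ψ => by simp [evalPhase_single]

theorem acceptBranch_evalEntangled {M n : ℕ} (hM : 2 < M) (V : QUnitary n) (N : ℕ)
    (A : ℕ →₀ State) :
    acceptBranch (evalEntangled M V N A) =
      evalEntangled M V N (Finsupp.mapRange.linearMap acceptBranch A) := by
  suffices acceptBranch ∘ₗ evalEntangled M V N =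
      evalEntangled M V N ∘ₗ Finsupp.mapRange.linearMap acceptBranch from
    LinearMap.congr_fun this A
  exact Finsupp.lhom_ext fun k ψ => by
    simp [evalEntangled_single, entangled_apply, acceptBranch_spliceLin hM]

theorem sum_acceptProb_phaseMul {M n : ℕ} (V : QUnitary n) (hM : 2 < M) {S : Set QueryOp}
    {c : Circuit} (hc : c.Allowed (Query.controlled '' S)) (hcM : ∀ g ∈ c, g.ArraysLT M)
    (hcount : controlledCount c < 2 ^ n) :
    ∑ x : Fin (2 ^ n), acceptProb (phaseMul x V : QMatrix n) c =
      2 ^ n * acceptProb (V : QMatrix n) (prepare M n ++ simulate M n 1 c) := by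
  obtain ⟨m, N, B, hB, hmain, hphase, hsim⟩ := exists_phaseExpansion V (one_lt_two.trans hM) hc hcM
    0 0 (A := Finsupp.single 0 (ket ∅)) (Finsupp.single_mem_supported _ _ (Set.mem_Iio.mpr one_pos))
    (by simp [spliceLin_ket, splice])
  set C := Finsupp.mapRange.linearMap acceptBranch B with hC
  have hCsupp : C ∈ Finsupp.supported State ℂ (Set.Iio (2 ^ n)) := fun k hk =>
    (hB (Finsupp.support_mapRange (hf := map_zero acceptBranch) hk)).trans_le
      (Nat.one_add_le_iff.mpr hcount)
  have hCmain (k : ℕ) : spliceLin M ∅ (C k) = C k := by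
    rw [hC, Finsupp.mapRange.linearMap_apply, Finsupp.mapRange_apply, ← acceptBranch_spliceLin hM]
    exact congrArg acceptBranch (DFunLike.congr_fun hmain k)
  have hroot : ‖((1 / Real.sqrt 2 : ℝ) : ℂ) ^ n‖ ^ 2 * 2 ^ n = 1 := by
    rw [norm_pow, Complex.norm_real, Real.norm_of_nonneg (by positivity), ← pow_mul, mul_comm n,
      pow_mul, div_pow, Real.sq_sqrt (by norm_num), one_pow, ← mul_pow]
    norm_num
  have hphased (x : Fin (2 ^ n)) : acceptProb (phaseMul x V : QMatrix n) c =
      normSq (evalPhase (rootPhase n x) m C) := by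
    rw [acceptProb_eq, hC, ← acceptBranch_evalPhase, ← hphase _ (norm_rootPhase n x),
      evalPhase_single]
    simp [phaseMul]
  have hsimulated : acceptProb (V : QMatrix n) (prepare M n ++ simulate M n 1 c) =
      C.sum fun _ ψ => normSq ψ := by
    have hstart : entangled M (1 : QMatrix n) {0} (ket ∅) =
        evalEntangled M V 0 (Finsupp.single 0 (ket ∅)) := by
      simp [evalEntangled_single, counter]
    rw [acceptProb_eq, runLin_append, runLin_prepare, hstart, map_smul, hsim, map_smul,
      acceptBranch_evalEntangled hM, normSq_smul, normSq_evalEntangled V N hCmain, ← mul_assoc,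
      hroot, one_mul]
  simp only [hphased, hsimulated, sum_normSq_evalPhase m hCsupp]

/-! ## Continuity and the Haar measure -/

/-- A state that depends continuously on a parameter, with support in a fixed finite set. -/
def ContinuousState {X : Type*} [TopologicalSpace X] (Ψ : X → State) : Prop :=
  ∃ F : Finset (Finset Wire), (∀ V, (Ψ V).support ⊆ F) ∧ ∀ s, Continuous fun V => Ψ V s

namespace ContinuousState

variable {X : Type*} [TopologicalSpace X] {Ψ Φ : X → State}

theorem const (ψ : State) : ContinuousState fun _ : X => ψ :=
  ⟨ψ.support, fun _ => subset_rfl, fun _ => continuous_const⟩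

theorem smul (h : ContinuousState Ψ) {f : X → ℂ} (hf : Continuous f) :
    ContinuousState fun V => f V • Ψ V := by
  obtain ⟨F, hF, hΨ⟩ := h
  exact ⟨F, fun V => Finsupp.support_smul.trans (hF V), fun s => hf.mul (hΨ s)⟩

theorem add (h : ContinuousState Ψ) (h' : ContinuousState Φ) :
    ContinuousState fun V => Ψ V + Φ V := by
  classical
  obtain ⟨F, hF, hΨ⟩ := h
  obtain ⟨G, hG, hΦ⟩ := h'
  exact ⟨F ∪ G, fun V => Finsupp.support_add.trans (Finset.union_subset_union (hF V) (hG V)),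
    fun s => (hΨ s).add (hΦ s)⟩

theorem sum {ι : Type*} (I : Finset ι) {Ψ : ι → X → State} (h : ∀ i ∈ I, ContinuousState (Ψ i)) :
    ContinuousState fun V => ∑ i ∈ I, Ψ i V := by
  classical
  induction I using Finset.induction_on with
  | empty => exact const 0
  | insert i I hi ih =>
    simp only [Finset.sum_insert hi]
    exact (h i (Finset.mem_insert_self i I)).add
      (ih fun j hj => h j (Finset.mem_insert_of_mem hj))

theorem extend (h : ContinuousState Ψ) {f : X → Finset Wire → State}
    (hf : ∀ s, ContinuousState fun V => f V s) : ContinuousState fun V => extend (f V) (Ψ V) := by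
  obtain ⟨F, hF, hΨ⟩ := h
  have hsum (V : X) : PRU.extend (f V) (Ψ V) = ∑ s ∈ F, Ψ V s • f V s := by
    rw [PRU.extend, Finsupp.linearCombination_apply,
      Finsupp.sum_of_support_subset _ (hF V) _ (by simp)]
  simp only [hsum]
  exact sum F fun s _ => (hf s).smul (hΨ s)

theorem continuous_normSq (h : ContinuousState Ψ) : Continuous fun V => normSq (Ψ V) := by
  obtain ⟨F, hF, hΨ⟩ := h
  simp only [normSq_eq_sum (hF _)]
  exact continuous_finsetSum _ fun s _ => (hΨ s).norm.pow 2

end ContinuousState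

theorem continuousState_applyTarget {n : ℕ} (o : QueryOp) (s : Finset Wire) :
    ContinuousState fun V : QUnitary n => applyTarget (o.apply (V : QMatrix n)) s := by
  have hV (y x) : Continuous fun V : QUnitary n => (V : QMatrix n) y x :=
    (continuous_apply_apply y x).comp continuous_subtype_val
  refine .sum _ fun y _ => (ContinuousState.const _).smul ?_
  cases o
  exacts [hV _ _, (hV _ _).star, (hV _ _).star, hV _ _]

theorem continuousState_onBasis {n : ℕ} (g : Gate ℕ) (s : Finset Wire) :
    ContinuousState fun V : QUnitary n => g.onBasis (V : QMatrix n) s := by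
  cases g with
  | query q =>
    cases q with
    | uncontrolled o => exact continuousState_applyTarget o s
    | controlled o =>
      simp only [Gate.onBasis]
      split_ifs
      exacts [continuousState_applyTarget o s, .const _]
  | _ => exact .const _

theorem continuousState_runLin {n : ℕ} (c : Circuit) {Ψ : QUnitary n → State}
    (hΨ : ContinuousState Ψ) :
    ContinuousState fun V : QUnitary n => runLin (V : QMatrix n) c (Ψ V) := by
  induction c generalizing Ψ with
  | nil => exact hΨ
  | cons g _ ih => exact ih (hΨ.extend (continuousState_onBasis g))

theorem continuous_acceptProb {n : ℕ} (c : Circuit) :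
    Continuous fun V : QUnitary n => acceptProb (V : QMatrix n) c := by
  have hrun : ContinuousState fun V : QUnitary n => runLin (V : QMatrix n) c (ket ∅) :=
    continuousState_runLin c (Ψ := fun _ => ket ∅) (.const _)
  have hacc : ContinuousState fun V : QUnitary n =>
      acceptBranch (runLin (V : QMatrix n) c (ket ∅)) :=
    hrun.extend (f := fun _ s => if (2, 0) ∈ s then ket s else 0) fun _ => .const _
  simpa only [acceptProb_eq] using hacc.continuous_normSq

instance isProbabilityMeasure_haar (n : ℕ) : IsProbabilityMeasure (haar n) := by
  constructor
  simpa [haar] using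
    Measure.haarMeasure_self (K₀ := (⊤ : TopologicalSpace.PositiveCompacts (QUnitary n)))

theorem phaseMul_eq_mul {n : ℕ} (x : Fin (2 ^ n)) (V : QUnitary n) :
    phaseMul x V = phaseMul x 1 * V :=
  Subtype.ext (by simp [phaseMul])

theorem integral_acceptProb_phaseMul {n : ℕ} (c : Circuit) (x : Fin (2 ^ n)) :
    ∫ V : QUnitary n, acceptProb (phaseMul x V : QMatrix n) c ∂(haar n) = haarAcceptProb n c := by
  have : (haar n).IsMulLeftInvariant := by
    unfold haar
    infer_instance
  let f (V : QUnitary n) : ℝ := acceptProb (V : QMatrix n) c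
  calc ∫ V, f (phaseMul x V) ∂(haar n) = ∫ V, f (phaseMul x 1 * V) ∂(haar n) :=
        integral_congr_ae (ae_of_all _ fun V => congrArg f (phaseMul_eq_mul x V))
    _ = haarAcceptProb n c := integral_mul_left_eq_self f _

theorem integrable_acceptProb_phaseMul {n : ℕ} (c : Circuit) (x : Fin (2 ^ n)) :
    Integrable (fun V : QUnitary n => acceptProb (phaseMul x V : QMatrix n) c) (haar n) := by
  have hcont : Continuous fun V : QUnitary n => phaseMul x V :=
    (continuous_subtype_val.const_smul (rootPhase n x)).subtype_mk _
  exact ((continuous_acceptProb c).comp hcont).integrable_of_hasCompactSupport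
    (HasCompactSupport.of_compactSpace _)

section Simulate

variable {M n : ℕ} (hM : 2 < M) {S : Set QueryOp} {c : Circuit}
  (hc : c.Allowed (Query.controlled '' S)) (hcM : ∀ g ∈ c, g.ArraysLT M)
  (hcount : controlledCount c < 2 ^ n)
include hM hc hcM hcount

theorem haarAcceptProb_simulate :
    haarAcceptProb n (prepare M n ++ simulate M n 1 c) = haarAcceptProb n c := by
  refine mul_left_cancel₀ (pow_ne_zero n (two_ne_zero (α := ℝ))) ?_
  rw [haarAcceptProb, ← integral_const_mul]
  simp only [← sum_acceptProb_phaseMul _ hM hc hcM hcount]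
  rw [integral_finsetSum _ fun x _ => integrable_acceptProb_phaseMul c x]
  simp [integral_acceptProb_phaseMul]

theorem keyAcceptProb_withPhase (𝒰 : UnitaryFamily) :
    𝒰.withPhase.keyAcceptProb n c = 𝒰.keyAcceptProb n (prepare M n ++ simulate M n 1 c) := by
  have hsum : ∑ k : 𝒰.withPhase.Key n, acceptProb (𝒰.withPhase.unitary n k : QMatrix n) c =
      ∑ k : 𝒰.Key n, 2 ^ n * acceptProb (𝒰.unitary n k : QMatrix n)
        (prepare M n ++ simulate M n 1 c) := by
    simp only [← sum_acceptProb_phaseMul _ hM hc hcM hcount]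
    exact Fintype.sum_prod_type _
  have hcard : (Fintype.card (𝒰.withPhase.Key n) : ℝ) = 2 ^ n * Fintype.card (𝒰.Key n) := by
    rw [mul_comm, show Fintype.card (𝒰.withPhase.Key n) = _ from Fintype.card_prod _ _]
    simp
  rw [UnitaryFamily.keyAcceptProb, UnitaryFamily.keyAcceptProb, hsum, hcard, ← Finset.mul_sum,
    mul_div_mul_left _ _ (by positivity)]

end Simulate

/-! ## Programs for the gadgets -/

/-- `Exec` with a bound on the number of steps. -/
def ExecLE (P : Prog) (s : Store) (c : Circuit) (B : ℕ) (s' : Store) : Prop :=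
  ∃ t ≤ B, Exec P s c t s'

theorem Exec.execLE {P : Prog} {s s' : Store} {c : Circuit} {t : ℕ} (h : Exec P s c t s') :
    ExecLE P s c t s' := ⟨t, le_rfl, h⟩

namespace ExecLE

variable {P Q : Prog} {s s₁ s₂ : Store} {c d : Circuit} {B B' : ℕ} {r : ℕ}

theorem mono (h : ExecLE P s c B s₁) (hB : B ≤ B') : ExecLE P s c B' s₁ := by
  obtain ⟨t, ht, h⟩ := h
  exact ⟨t, ht.trans hB, h⟩

theorem seq (h : ExecLE P s c B s₁) (h' : ExecLE Q s₁ d B' s₂) :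
    ExecLE (.seq P Q) s (c ++ d) (B + B') s₂ := by
  obtain ⟨t, ht, h⟩ := h
  obtain ⟨t', ht', h'⟩ := h'
  exact ⟨t + t', add_le_add ht ht', .seq h h'⟩

theorem seq_nil (h : ExecLE P s c B s₁) (h' : ExecLE Q s₁ [] B' s₂) :
    ExecLE (.seq P Q) s c (B + B') s₂ := by
  simpa using h.seq h'

theorem nil_seq (h : ExecLE P s [] B s₁) (h' : ExecLE Q s₁ d B' s₂) :
    ExecLE (.seq P Q) s d (B + B') s₂ := h.seq h'

theorem loopStep (hs : s r ≠ []) (h : ExecLE P s c B s₁) (h' : ExecLE (.loop r P) s₁ d B' s₂) :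
    ExecLE (.loop r P) s (c ++ d) (B + B' + 1) s₂ := by
  obtain ⟨t, ht, h⟩ := h
  obtain ⟨t', ht', h'⟩ := h'
  exact ⟨t + t' + 1, by omega, .loopStep hs h h'⟩

theorem loop {σ : ℕ → Store} {f : ℕ → Circuit} {v : ℕ} (hr : ∀ u ≤ v, (σ u r).length = u)
    (hP : ∀ u < v, ExecLE P (σ (u + 1)) (f u) B (σ u)) :
    ExecLE (.loop r P) (σ v) (descend f v) (v * (B + 1) + 1) (σ 0) := by
  induction v with
  | zero =>
    exact (Exec.loopDone (List.eq_nil_of_length_eq_zero (hr 0 le_rfl))).execLE.mono (by omega)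
  | succ v ih =>
    have hne : σ (v + 1) r ≠ [] := List.ne_nil_of_length_eq_add_one (hr _ le_rfl)
    refine (loopStep hne (hP v v.lt_succ_self)
      (ih (fun u hu => hr u (by omega)) fun u hu => hP u (by omega))).mono (le_of_eq ?_)
    ring

theorem descend_nil (v : ℕ) : descend (fun _ => []) v = [] := by
  induction v with
  | zero => rfl
  | succ _ ih => exact ih

theorem loop_nil {σ : ℕ → Store} {v : ℕ} (hr : ∀ u ≤ v, (σ u r).length = u)
    (hP : ∀ u < v, ExecLE P (σ (u + 1)) [] B (σ u)) :
    ExecLE (.loop r P) (σ v) [] (v * (B + 1) + 1) (σ 0) := by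
  simpa only [descend_nil] using loop hr hP

end ExecLE

/-- Run `P` while register `a` goes down to `0` by the program `down`. Register `i` counts the
rounds, so that the program `up` can then restore `a`. -/
def countdown (a i : ℕ) (down up P : Prog) : Prog :=
  .seq (.loop a (.seq down (.seq P (.push i true)))) (.loop i (.seq (.pop i) up))

theorem ExecLE.countdown {a i : ℕ} {down up P : Prog} {σ : ℕ → ℕ → Store} {f : ℕ → Circuit}
    {B v : ℕ} (ha : ∀ u k, (σ u k a).length = u) (hi : ∀ u k, (σ u k i).length = k)
    (hdown : ∀ u k, ExecLE down (σ (u + 1) k) [] 2 (σ u k))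
    (hup : ∀ u k, ExecLE up (σ u k) [] 2 (σ (u + 1) k))
    (hpush : ∀ u k, ExecLE (.push i true) (σ u k) [] 1 (σ u (k + 1)))
    (hpop : ∀ u k, ExecLE (.pop i) (σ u (k + 1)) [] 1 (σ u k))
    (hP : ∀ u < v, ∀ k, ExecLE P (σ u k) (f u) B (σ u k)) :
    ExecLE (countdown a i down up P) (σ v 0) (descend f v) (v * (B + 8) + 2) (σ v 0) := by
  have hrun : ExecLE (.loop a (.seq down (.seq P (.push i true)))) (σ v (v - v)) (descend f v)
      (v * (2 + (B + 1) + 1) + 1) (σ 0 (v - 0)) := by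
    refine loop (σ := fun u => σ u (v - u)) (fun u _ => ha u _) fun u hu => ?_
    have hround := (hdown u (v - (u + 1))).nil_seq ((hP u hu _).seq_nil (hpush u _))
    rwa [show v - (u + 1) + 1 = v - u by omega] at hround
  have hrestore : ExecLE (.loop i (.seq (.pop i) up)) (σ (v - v) v) [] (v * (1 + 2 + 1) + 1)
      (σ (v - 0) 0) := by
    refine loop_nil (σ := fun k => σ (v - k) k) (fun k _ => hi _ k) fun k hk => ?_
    have hround := (hpop (v - (k + 1)) k).seq_nil (hup (v - (k + 1)) k)
    rwa [show v - (k + 1) + 1 = v - k by omega] at hround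
  simp only [Nat.sub_self, Nat.sub_zero] at hrun hrestore
  exact (hrun.seq_nil hrestore).mono (le_of_eq (by ring))

/-- The store `s` below `M`, followed by registers `M`, `M + 1`, … with the heights in `l`. -/
def withAux (M : ℕ) (s : Store) (l : List ℕ) : Store :=
  fun r => if r < M then s r else List.replicate (l.getD (r - M) 0) true

section WithAux

variable (M : ℕ) (s : Store) (l : List ℕ)

theorem withAux_of_lt {M r : ℕ} (hr : r < M) : withAux M s l r = s r :=
  if_pos hr

theorem withAux_add (a : ℕ) : withAux M s l (M + a) = List.replicate (l.getD a 0) true := by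
  simp [withAux]

theorem withAux_self : withAux M s l M = List.replicate (l.getD 0 0) true :=
  withAux_add M s l 0

theorem update_withAux_of_lt {M r : ℕ} (hr : r < M) (w : List Bool) :
    Function.update (withAux M s l) r w = withAux M (Function.update s r w) l := by
  funext i
  simp only [Function.update_apply, withAux]
  grind

theorem update_withAux_add {a : ℕ} (ha : a < l.length) (v : ℕ) :
    Function.update (withAux M s l) (M + a) (List.replicate v true) =
      withAux M s (l.set a v) := by
  funext i
  simp only [Function.update_apply, withAux, List.getD_eq_getElem?_getD, List.getElem?_set]
  grind

theorem execLE_push {a : ℕ} (ha : a < l.length) :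
    ExecLE (.push (M + a) true) (withAux M s l) [] 1 (withAux M s (l.set a (l.getD a 0 + 1))) := by
  have h := Exec.push (M + a) true (withAux M s l)
  rw [withAux_add, ← List.replicate_succ, update_withAux_add M s l ha] at h
  exact h.execLE

theorem execLE_pop {a : ℕ} (ha : a < l.length) :
    ExecLE (.pop (M + a)) (withAux M s l) [] 1 (withAux M s (l.set a (l.getD a 0 - 1))) := by
  have h := Exec.pop (M + a) (withAux M s l)
  rw [withAux_add, List.tail_replicate, update_withAux_add M s l ha] at h
  exact h.execLE

end WithAux

/-- The total cost of a circuit. -/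
def totalCost (c : Circuit) : ℕ := (c.map Gate.cost).sum

/-- Apply a list of gates. -/
def emitAll : List (Gate ℕ) → Prog
  | [] => .skip
  | g :: gs => .seq (.emit g) (emitAll gs)

theorem execLE_emitAll {gs : List (Gate ℕ)} {s : Store} {c : Circuit} {B : ℕ}
    (hc : gs.map (Gate.map fun r => (s r).length) = c) (hB : totalCost c < B) :
    ExecLE (emitAll gs) s c B s := by
  subst hc
  refine ExecLE.mono ?_ (Nat.succ_le_of_lt hB)
  clear hB
  induction gs with
  | nil => exact (Exec.skip s).execLE
  | cons g gs ih =>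
    refine ((Exec.emit g s).execLE.seq ih).mono (le_of_eq ?_)
    simp [totalCost, add_assoc]

/-- The auxiliary registers of the simulation: `0`, the number `n` of qubits, the number `v` of
possible values of the counter, `v + 1`, and a register for loops. -/
def auxStore (M : ℕ) (s : Store) (n v : ℕ) : Store := withAux M s [0, n, v, v + 1, 0]

/-- A program for `descend f n`, where `P` is a program for `f u` if register `M + 1` is `u`. -/
def overQubits (M : ℕ) (P : Prog) : Prog :=
  countdown (M + 1) (M + 4) (.pop (M + 1)) (.push (M + 1) true) P

/-- A program for `descend f v`, where `P` is a program for `f u` if registers `M + 2` and `M + 3`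
are `u` and `u + 1`. -/
def overCounter (M : ℕ) (P : Prog) : Prog :=
  countdown (M + 2) (M + 4) (.seq (.pop (M + 2)) (.pop (M + 3)))
    (.seq (.push (M + 2) true) (.push (M + 3) true)) P

section AuxStore

variable {M : ℕ} {s : Store} {n v B : ℕ} {P : Prog} {f : ℕ → Circuit}

theorem execLE_overQubits
    (hP : ∀ u < n, ∀ k, ExecLE P (withAux M s [0, u, v, v + 1, k]) (f u) B
      (withAux M s [0, u, v, v + 1, k])) :
    ExecLE (overQubits M P) (auxStore M s n v) (descend f n) (n * (B + 8) + 2)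
      (auxStore M s n v) := by
  refine ExecLE.countdown (σ := fun u k => withAux M s [0, u, v, v + 1, k])
    (fun u k => by simp [withAux_add]) (fun u k => by simp [withAux_add]) (fun u k => ?_)
    (fun u k => ?_) (fun u k => ?_) (fun u k => ?_) hP
  · exact (execLE_pop M s [0, u + 1, v, v + 1, k] (a := 1) (by simp)).mono one_le_two
  · exact (execLE_push M s [0, u, v, v + 1, k] (a := 1) (by simp)).mono one_le_two
  · exact execLE_push M s [0, u, v, v + 1, k] (a := 4) (by simp)
  · exact execLE_pop M s [0, u, v, v + 1, k + 1] (a := 4) (by simp)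

theorem execLE_overCounter
    (hP : ∀ u < v, ∀ k, ExecLE P (withAux M s [0, n, u, u + 1, k]) (f u) B
      (withAux M s [0, n, u, u + 1, k])) :
    ExecLE (overCounter M P) (auxStore M s n v) (descend f v) (v * (B + 8) + 2)
      (auxStore M s n v) := by
  refine ExecLE.countdown (σ := fun u k => withAux M s [0, n, u, u + 1, k])
    (fun u k => by simp [withAux_add]) (fun u k => by simp [withAux_add]) (fun u k => ?_)
    (fun u k => ?_) (fun u k => ?_) (fun u k => ?_) hP
  · exact (execLE_pop M s [0, n, u + 1, u + 2, k] (a := 2) (by simp)).seq_nil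
      (execLE_pop M s [0, n, u, u + 2, k] (a := 3) (by simp))
  · exact (execLE_push M s [0, n, u, u + 1, k] (a := 2) (by simp)).seq_nil
      (execLE_push M s [0, n, u + 1, u + 1, k] (a := 3) (by simp))
  · exact execLE_push M s [0, n, u, u + 1, k] (a := 4) (by simp)
  · exact execLE_pop M s [0, n, u, u + 1, k + 1] (a := 4) (by simp)

/-- A program for `descend (ctrlSwap d) n`. -/
def ctrlSwapProg (M d : ℕ) : Prog :=
  overQubits M (emitAll [.cnot (d, M + 1) (0, M + 1), .toffoli (1, M) (0, M + 1) (d, M + 1),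
    .cnot (d, M + 1) (0, M + 1)])

theorem execLE_ctrlSwapProg (d : ℕ) :
    ExecLE (ctrlSwapProg M d) (auxStore M s n v) (descend (ctrlSwap d) n) (n * (6 * n + 12) + 2)
      (auxStore M s n v) := by
  refine execLE_overQubits (B := 6 * n + 4) fun u hu k => execLE_emitAll ?_ ?_
  · simp [Gate.map, ctrlSwap, withAux_self, withAux_add]
  · simp only [totalCost, ctrlSwap, List.map_cons, List.map_nil, List.sum_cons, List.sum_nil,
      Gate.cost]
    omega

/-- A program for `descend (entangle M) n`. -/
def entangleProg (M : ℕ) : Prog :=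
  overQubits M (emitAll [.hadamard (M, M + 1), .cnot (M, M + 1) (M + 1, M + 1)])

theorem execLE_entangleProg :
    ExecLE (entangleProg M) (auxStore M s n v) (descend (entangle M) n) (n * (3 * n + 12) + 2)
      (auxStore M s n v) := by
  refine execLE_overQubits (B := 3 * n + 4) fun u hu k => execLE_emitAll ?_ ?_
  · simp [Gate.map, entangle, withAux_add]
  · simp only [totalCost, entangle, List.map_cons, List.map_nil, List.sum_cons, List.sum_nil,
      Gate.cost]
    omega

/-- A program for `descend (counterGate (M + 2)) v`. -/
def counterProg (M : ℕ) : Prog :=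
  overCounter M (emitAll [.toffoli (1, M) (M + 2, M + 2) (M + 2, M + 3)])

theorem execLE_counterProg :
    ExecLE (counterProg M) (auxStore M s n v) (descend (counterGate (M + 2)) v)
      (v * (2 * v + 12) + 2) (auxStore M s n v) := by
  refine execLE_overCounter (B := 2 * v + 4) fun u hu k => execLE_emitAll ?_ ?_
  · simp [Gate.map, counterGate, withAux_self, withAux_add]
  · simp only [totalCost, counterGate, List.map_cons, List.map_nil, List.sum_cons, List.sum_nil,
      Gate.cost]
    omega

/-- A program for `[.not (1, 0)]`. -/
def flipControl (M : ℕ) : Prog := emitAll [.not (1, M)]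

theorem execLE_flipControl :
    ExecLE (flipControl M) (auxStore M s n v) [.not (1, 0)] 2 (auxStore M s n v) :=
  execLE_emitAll (by simp [Gate.map, auxStore, withAux_self])
    (by simp [totalCost, Gate.cost])

/-- A program for `countQuery M v o`. -/
def countQueryProg (M : ℕ) : QueryOp → Prog
  | .plain | .transpose => counterProg M
  | .adjoint | .conj => .seq (.seq (flipControl M) (counterProg M)) (flipControl M)

theorem execLE_countQueryProg (o : QueryOp) :
    ExecLE (countQueryProg M o) (auxStore M s n v) (countQuery M v o) (v * (2 * v + 12) + 6)
      (auxStore M s n v) := by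
  have hflipped := (execLE_flipControl.seq execLE_counterProg).seq
    (execLE_flipControl (M := M) (s := s) (n := n) (v := v))
  cases o
  · exact execLE_counterProg.mono (by omega)
  · exact hflipped.mono (by omega)
  · exact hflipped.mono (by omega)
  · exact execLE_counterProg.mono (by omega)

/-- A program for `redirect d n o`. -/
def redirectProg (M d : ℕ) (o : QueryOp) : Prog :=
  .seq (.seq (.seq (.seq (flipControl M) (ctrlSwapProg M d)) (.emit (.query (.uncontrolled o))))
    (ctrlSwapProg M d)) (flipControl M)

theorem execLE_redirectProg (d : ℕ) (o : QueryOp) :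
    ExecLE (redirectProg M d o) (auxStore M s n v) (redirect d n o) (2 * n * (6 * n + 12) + 9)
      (auxStore M s n v) := by
  have hquery : ExecLE (.emit (.query (.uncontrolled o))) (auxStore M s n v)
      [.query (.uncontrolled o)] 1 (auxStore M s n v) := (Exec.emit _ _).execLE
  refine ((((execLE_flipControl.seq (execLE_ctrlSwapProg d)).seq hquery).seq
    (execLE_ctrlSwapProg d)).seq execLE_flipControl).mono (le_of_eq ?_)
  ring

/-- A program for `gadget M n v o`, which also updates the registers for `v`. -/
def gadgetProg (M : ℕ) (o : QueryOp) : Prog :=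
  .seq (.seq (countQueryProg M o) (redirectProg M (o.idleArray M) o))
    (.seq (.push (M + 2) true) (.push (M + 3) true))

theorem execLE_gadgetProg (o : QueryOp) :
    ExecLE (gadgetProg M o) (auxStore M s n v) (gadget M n v o) (24 * (n + v + 1) ^ 2)
      (auxStore M s n (v + 1)) := by
  have hpush : ExecLE (.seq (.push (M + 2) true) (.push (M + 3) true)) (auxStore M s n v) [] 2
      (auxStore M s n (v + 1)) :=
    (execLE_push M s [0, n, v, v + 1, 0] (a := 2) (by simp)).seq_nil
      (execLE_push M s [0, n, v + 1, v + 1, 0] (a := 3) (by simp))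
  refine (((execLE_countQueryProg o).seq (execLE_redirectProg _ o)).seq_nil hpush).mono ?_
  nlinarith [Nat.zero_le (n * v)]

end AuxStore

/-! ## Simulation of adversaries -/

/-- All registers in the gate are below `M`. -/
def Gate.RegistersLT (M : ℕ) : Gate ℕ → Prop
  | .not a => a.2 < M
  | .cnot a b => a.2 < M ∧ b.2 < M
  | .toffoli a b c => a.2 < M ∧ b.2 < M ∧ c.2 < M
  | .hadamard a => a.2 < M
  | .phase j a => j < M ∧ a.2 < M
  | .query _ => True

/-- The program only uses registers and arrays below `M`. -/
def Prog.BoundedBy (M : ℕ) : Prog → Prop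
  | .skip => True
  | .push r _ => r < M
  | .pop r => r < M
  | .emit g => g.ArraysLT M ∧ g.RegistersLT M
  | .seq p q => p.BoundedBy M ∧ q.BoundedBy M
  | .branch r p q t => r < M ∧ p.BoundedBy M ∧ q.BoundedBy M ∧ t.BoundedBy M
  | .loop r p => r < M ∧ p.BoundedBy M

theorem Gate.eventually_arraysLT {ι : Type} (g : Gate ι) : ∀ᶠ M in atTop, g.ArraysLT M := by
  cases g with
  | not a => exact eventually_gt_atTop a.1
  | cnot a b => exact (eventually_gt_atTop a.1).and (eventually_gt_atTop b.1)
  | toffoli a b c =>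
    exact (eventually_gt_atTop a.1).and
      ((eventually_gt_atTop b.1).and (eventually_gt_atTop c.1))
  | hadamard a => exact eventually_gt_atTop a.1
  | phase j a => exact eventually_gt_atTop a.1
  | query q => exact eventually_gt_atTop 1

theorem Gate.eventually_registersLT (g : Gate ℕ) : ∀ᶠ M in atTop, g.RegistersLT M := by
  cases g with
  | not a => exact eventually_gt_atTop a.2
  | cnot a b => exact (eventually_gt_atTop a.2).and (eventually_gt_atTop b.2)
  | toffoli a b c =>
    exact (eventually_gt_atTop a.2).and
      ((eventually_gt_atTop b.2).and (eventually_gt_atTop c.2))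
  | hadamard a => exact eventually_gt_atTop a.2
  | phase j a => exact (eventually_gt_atTop j).and (eventually_gt_atTop a.2)
  | query q => exact .of_forall fun _ => trivial

theorem Prog.eventually_boundedBy (P : Prog) : ∀ᶠ M in atTop, P.BoundedBy M := by
  induction P with
  | skip => exact .of_forall fun _ => trivial
  | push r _ => exact eventually_gt_atTop r
  | pop r => exact eventually_gt_atTop r
  | emit g => exact g.eventually_arraysLT.and g.eventually_registersLT
  | seq p q hp hq => exact hp.and hq
  | branch r p q t hp hq ht => exact (eventually_gt_atTop r).and (hp.and (hq.and ht))
  | loop r p hp => exact (eventually_gt_atTop r).and hp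

theorem Exec.arraysLT {M : ℕ} {P : Prog} {s s' : Store} {c : Circuit} {t : ℕ}
    (h : Exec P s c t s') (hP : P.BoundedBy M) : ∀ g ∈ c, g.ArraysLT M := by
  induction h with
  | emit g s =>
    have hmap (f : ℕ → ℕ) : (g.map f).ArraysLT M := by
      have hg := hP.1
      cases g <;> exact hg
    exact List.forall_mem_singleton.mpr (hmap _)
  | seq _ _ h₁ h₂ => exact List.forall_mem_append.mpr ⟨h₁ hP.1, h₂ hP.2⟩
  | branchEmpty _ _ h => exact h hP.2.1
  | branchFalse _ _ h => exact h hP.2.2.1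
  | branchTrue _ _ h => exact h hP.2.2.2
  | loopStep _ _ _ h₁ h₂ => exact List.forall_mem_append.mpr ⟨h₁ hP.2, h₂ hP⟩
  | _ => simp

theorem controlledCount_append (c d : Circuit) :
    controlledCount (c ++ d) = controlledCount c + controlledCount d := by
  simp [controlledCount]

theorem controlledCount_singleton (g : Gate ℕ) : controlledCount [g] = g.controlledCount := by
  simp [controlledCount]

theorem Gate.one_le_cost (g : Gate ℕ) : 1 ≤ g.cost := by
  cases g <;> simp [Gate.cost]

theorem Gate.controlledCount_le_one {ι : Type} (g : Gate ι) : g.controlledCount ≤ 1 := by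
  rcases g with _ | _ | _ | _ | _ | _ | _ <;> simp [Gate.controlledCount]

theorem Gate.controlledCount_map {ι κ : Type} (g : Gate ι) (f : ι → κ) :
    (g.map f).controlledCount = g.controlledCount := by
  rcases g with _ | _ | _ | _ | _ | _ | _ <;> rfl

theorem Exec.controlledCount_le {P : Prog} {s s' : Store} {c : Circuit} {t : ℕ}
    (h : Exec P s c t s') : controlledCount c ≤ t := by
  induction h with
  | emit g s =>
    rw [controlledCount_singleton]
    exact (Gate.controlledCount_le_one _).trans (Gate.one_le_cost _)
  | seq | loopStep =>
    rw [controlledCount_append]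
    omega
  | branchEmpty | branchFalse | branchTrue => omega
  | _ => simp [controlledCount]

theorem simulate_append (M n v : ℕ) (c d : Circuit) :
    simulate M n v (c ++ d) = simulate M n v c ++ simulate M n (v + controlledCount c) d := by
  induction c generalizing v with
  | nil => rfl
  | cons g c ih =>
    have hcount : controlledCount (g :: c) = g.controlledCount + controlledCount c := rfl
    simp only [List.cons_append, simulate, ih, hcount, List.append_assoc, add_assoc]

/-- The program that runs `P` with controlled queries replaced by gadgets. -/
def simulateProg (M : ℕ) : Prog → Prog
  | .emit (.query (.controlled o)) => gadgetProg M o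
  | .emit g => .emit g
  | .seq p q => .seq (simulateProg M p) (simulateProg M q)
  | .branch r p q t => .branch r (simulateProg M p) (simulateProg M q) (simulateProg M t)
  | .loop r p => .loop r (simulateProg M p)
  | .skip => .skip
  | .push r b => .push r b
  | .pop r => .pop r

theorem Gate.map_congr {M : ℕ} {g : Gate ℕ} (hg : g.RegistersLT M) {f f' : ℕ → ℕ}
    (h : ∀ r < M, f r = f' r) : g.map f = g.map f' := by
  cases g with
  | not a => simp only [Gate.map, h _ hg]
  | cnot a b => simp only [Gate.map, h _ hg.1, h _ hg.2]
  | toffoli a b c => simp only [Gate.map, h _ hg.1, h _ hg.2.1, h _ hg.2.2]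
  | hadamard a => simp only [Gate.map, h _ hg]
  | phase j a => simp only [Gate.map, h _ hg.1, h _ hg.2]
  | query q => rfl

section Simulate

variable {M n : ℕ}

theorem auxStore_of_lt {r : ℕ} (hr : r < M) (s : Store) (v : ℕ) : auxStore M s n v r = s r :=
  withAux_of_lt _ _ hr

theorem execLE_simulateProg_emit {g : Gate ℕ} (hg : g.RegistersLT M) (s : Store) (v : ℕ) {G : ℕ}
    (hG : 24 * (n + v + g.controlledCount) ^ 2 ≤ G) :
    ExecLE (simulateProg M (.emit g)) (auxStore M s n v)
      ((g.map fun r => (s r).length).simulate M n v)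
      ((g.map fun r => (s r).length).cost * (G + 1)) (auxStore M s n (v + g.controlledCount)) := by
  have hmap : (g.map fun r => (auxStore M s n v r).length) = g.map fun r => (s r).length :=
    Gate.map_congr hg fun r hr => by rw [auxStore_of_lt hr]
  have hemit := (Exec.emit g (auxStore M s n v)).execLE
  rw [hmap] at hemit
  replace hemit := hemit.mono (Nat.le_mul_of_pos_right _ G.succ_pos)
  rcases g with _ | _ | _ | _ | _ | o | o
  case query.controlled =>
    exact (execLE_gadgetProg o).mono (hG.trans (by simp [Gate.map, Gate.cost]))
  all_goals exact hemit

theorem Exec.simulate {P : Prog} {s s' : Store} {c : Circuit} {t : ℕ} (h : Exec P s c t s')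
    (hP : P.BoundedBy M) {v K : ℕ} (hK : v + controlledCount c ≤ K) :
    ExecLE (simulateProg M P) (auxStore M s n v) (simulate M n v c)
      (t * (24 * (n + K) ^ 2 + 1)) (auxStore M s' n (v + controlledCount c)) := by
  induction h generalizing v with
  | skip s => exact (Exec.skip _).execLE.mono (by omega)
  | push r b s =>
    have hpush := Exec.push r b (auxStore M s n v)
    rw [auxStore_of_lt hP, auxStore, update_withAux_of_lt _ _ hP] at hpush
    exact hpush.execLE.mono (by omega)
  | pop r s =>
    have hpop := Exec.pop r (auxStore M s n v)
    rw [auxStore_of_lt hP, auxStore, update_withAux_of_lt _ _ hP] at hpop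
    exact hpop.execLE.mono (by omega)
  | emit g s =>
    rw [controlledCount_singleton, Gate.controlledCount_map] at hK ⊢
    rw [PRU.simulate, PRU.simulate, List.append_nil]
    exact execLE_simulateProg_emit hP.2 s v
      (Nat.mul_le_mul_left _ (Nat.pow_le_pow_left (by omega) 2))
  | seq _ _ h₁ h₂ =>
    rw [controlledCount_append] at hK
    rw [simulate_append, controlledCount_append, ← add_assoc, add_mul]
    exact (h₁ hP.1 (by omega)).seq (h₂ hP.2 (by omega))
  | branchEmpty hs _ h =>
    obtain ⟨t', ht', h'⟩ := h hP.2.1 hK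
    exact ⟨t' + 1, by rw [add_mul]; omega, .branchEmpty (by rwa [auxStore_of_lt hP.1]) h'⟩
  | branchFalse hs _ h =>
    obtain ⟨t', ht', h'⟩ := h hP.2.2.1 hK
    exact ⟨t' + 1, by rw [add_mul]; omega, .branchFalse (by rwa [auxStore_of_lt hP.1]) h'⟩
  | branchTrue hs _ h =>
    obtain ⟨t', ht', h'⟩ := h hP.2.2.2 hK
    exact ⟨t' + 1, by rw [add_mul]; omega, .branchTrue (by rwa [auxStore_of_lt hP.1]) h'⟩
  | loopDone hs =>
    exact (Exec.loopDone (by rwa [auxStore_of_lt hP.1])).execLE.mono (by omega)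
  | loopStep hs _ _ h₁ h₂ =>
    rw [controlledCount_append] at hK
    rw [simulate_append, controlledCount_append, ← add_assoc, add_mul, add_mul]
    refine (ExecLE.loopStep (by rwa [auxStore_of_lt hP.1]) (h₁ hP.2 (by omega))
      (h₂ hP (by omega))).mono (by omega)

/-- Copy register `0`, with content `n` in unary, to register `M + 1`. -/
def copyProg (M : ℕ) : Prog :=
  .seq (.loop 0 (.seq (.pop 0) (.seq (.push (M + 1) true) (.push (M + 4) true))))
    (.loop (M + 4) (.seq (.pop (M + 4)) (.push 0 true)))

theorem execLE_copyProg (hM : 0 < M) {s : Store} (hs : s 0 = List.replicate n true) :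
    ExecLE (copyProg M) (withAux M s [0, 0, 0, 0, 0]) [] (7 * n + 2)
      (withAux M s [0, n, 0, 0, 0]) := by
  let σ (u a k : ℕ) : Store :=
    withAux M (Function.update s 0 (List.replicate u true)) [0, a, 0, 0, k]
  have hσ (a k : ℕ) : σ n a k = withAux M s [0, a, 0, 0, k] := by
    simp only [σ, ← hs, Function.update_eq_self]
  have hzero (u a k : ℕ) : σ u a k 0 = List.replicate u true := by simp [σ, withAux_of_lt _ _ hM]
  have hpop (u a k : ℕ) : ExecLE (.pop 0) (σ (u + 1) a k) [] 1 (σ u a k) := by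
    have h := Exec.pop 0 (σ (u + 1) a k)
    rw [hzero, update_withAux_of_lt _ _ hM, Function.update_idem] at h
    exact h.execLE
  have hpush (u a k : ℕ) : ExecLE (.push 0 true) (σ u a k) [] 1 (σ (u + 1) a k) := by
    have h := Exec.push 0 true (σ u a k)
    rw [hzero, update_withAux_of_lt _ _ hM, Function.update_idem] at h
    exact h.execLE
  have hcopy := ExecLE.loop_nil (P := .seq (.pop 0) (.seq (.push (M + 1) true)
      (.push (M + 4) true))) (r := 0) (B := 3) (v := n) (σ := fun u => σ u (n - u) (n - u))
    (fun u _ => by simp [hzero]) fun u hu => by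
      rw [show n - u = n - (u + 1) + 1 by omega]
      exact (hpop u _ _).seq_nil ((execLE_push M _ [0, _, 0, 0, _] (a := 1) (by simp)).seq_nil
        (execLE_push M _ [0, _, 0, 0, _] (a := 4) (by simp)))
  have hrestore := ExecLE.loop_nil (P := .seq (.pop (M + 4)) (.push 0 true)) (r := M + 4) (B := 2)
    (v := n) (σ := fun k => σ (n - k) n k) (fun k _ => by simp [σ, withAux_add]) fun k hk => by
      rw [show n - k = n - (k + 1) + 1 by omega]
      exact (execLE_pop M _ [0, _, 0, 0, k + 1] (a := 4) (by simp)).seq_nil (hpush _ n k)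
  simp only [Nat.sub_self, Nat.sub_zero] at hcopy hrestore
  rw [hσ] at hcopy hrestore
  exact (hcopy.seq_nil hrestore).mono (by omega)

theorem withAux_inputStore (hM : 2 < M) (w : List Bool) (m : ℕ) :
    withAux M (inputStore n w m) [0, 0, 0, 0, 0] = inputStore n w m := by
  funext r
  by_cases hr : r < M
  · exact withAux_of_lt _ _ hr
  · obtain ⟨i, rfl⟩ := Nat.exists_eq_add_of_le' (show 3 ≤ r by omega)
    have hzero : [0, 0, 0, 0, 0].getD (i + 3 - M) 0 = 0 := by grind
    rw [withAux, if_neg hr, hzero]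
    rfl

/-- Set up the auxiliary registers and run `prepare M n`. -/
def prepareProg (M : ℕ) : Prog :=
  .seq (.seq (copyProg M) (.seq (.push (M + 2) true) (.seq (.push (M + 3) true)
    (.push (M + 3) true)))) (.seq (emitAll [.not (M + 2, M)]) (entangleProg M))

theorem execLE_prepareProg (hM : 2 < M) (w : List Bool) (m : ℕ) :
    ExecLE (prepareProg M) (inputStore n w m) (prepare M n) (24 * (n + 1) ^ 2)
      (auxStore M (inputStore n w m) n 1) := by
  have hcopy := execLE_copyProg (M := M) (s := inputStore n w m) (n := n) (by omega) rfl
  rw [withAux_inputStore hM] at hcopy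
  have hcounter := (execLE_push M (inputStore n w m) [0, n, 0, 0, 0] (a := 2) (by simp)).seq_nil
    ((execLE_push M _ [0, n, 1, 0, 0] (a := 3) (by simp)).seq_nil
      (execLE_push M _ [0, n, 1, 1, 0] (a := 3) (by simp)))
  have hnot : ExecLE (emitAll [.not (M + 2, M)]) (auxStore M (inputStore n w m) n 1)
      [.not (M + 2, 0)] 2 (auxStore M (inputStore n w m) n 1) :=
    execLE_emitAll (by simp [Gate.map, auxStore, withAux_self]) (by simp [totalCost, Gate.cost])
  refine ((hcopy.seq_nil hcounter).nil_seq (hnot.seq execLE_entangleProg)).mono ?_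
  nlinarith

end Simulate

section Allowed

variable {Q : Set Query}

theorem allowed_append {c d : Circuit} (hc : c.Allowed Q) (hd : d.Allowed Q) :
    Circuit.Allowed Q (c ++ d) :=
  List.forall_mem_append.mpr ⟨hc, hd⟩

theorem allowed_descend {f : ℕ → Circuit} (hf : ∀ u, (f u).Allowed Q) (v : ℕ) :
    (descend f v).Allowed Q := by
  induction v with
  | zero => exact List.forall_mem_nil _
  | succ v ih => exact allowed_append (hf v) ih

theorem allowed_countQuery (M v : ℕ) (o : QueryOp) : (countQuery M v o).Allowed Q := by
  have hcounter : (descend (counterGate (M + 2)) v).Allowed Q :=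
    allowed_descend (fun u => by simp [counterGate, Circuit.Allowed, Gate.Allowed]) v
  have hnot : Circuit.Allowed Q [.not (1, 0)] := by simp [Circuit.Allowed, Gate.Allowed]
  cases o
  exacts [hcounter, allowed_append (allowed_append hnot hcounter) hnot,
    allowed_append (allowed_append hnot hcounter) hnot, hcounter]

theorem allowed_redirect (d n : ℕ) {o : QueryOp} (ho : .uncontrolled o ∈ Q) :
    (redirect d n o).Allowed Q := by
  have hswap : (descend (ctrlSwap d) n).Allowed Q :=
    allowed_descend (fun u => by simp [ctrlSwap, Circuit.Allowed, Gate.Allowed]) n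
  have hnot : Circuit.Allowed Q [.not (1, 0)] := by simp [Circuit.Allowed, Gate.Allowed]
  have hquery : Circuit.Allowed Q [.query (.uncontrolled o)] := by
    simpa [Circuit.Allowed, Gate.Allowed] using ho
  exact allowed_append (allowed_append (allowed_append (allowed_append hnot hswap) hquery) hswap)
    hnot

theorem allowed_prepare (M n : ℕ) : (prepare M n).Allowed Q :=
  allowed_append (by simp [Circuit.Allowed, Gate.Allowed])
    (allowed_descend (fun u => by simp [entangle, Circuit.Allowed, Gate.Allowed]) n)

theorem allowed_simulate {S : Set QueryOp} {c : Circuit}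
    (hc : c.Allowed (Query.controlled '' S)) (M n v : ℕ) :
    (simulate M n v c).Allowed (Query.uncontrolled '' S) := by
  induction c generalizing v with
  | nil => exact List.forall_mem_nil _
  | cons g c ih =>
    obtain ⟨hg, hc⟩ := List.forall_mem_cons.mp hc
    refine allowed_append ?_ (ih hc _)
    rcases g with _ | _ | _ | _ | _ | _ | o
    case query.controlled =>
      obtain ⟨o, ho, ⟨⟩⟩ := hg
      exact allowed_append (allowed_countQuery M v o) (allowed_redirect _ n ⟨o, ho, rfl⟩)
    case query.uncontrolled => exact absurd hg (by simp [Gate.Allowed])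
    all_goals simp [Gate.simulate, Circuit.Allowed, Gate.Allowed]

end Allowed

theorem isEfficientOracleCircuit_simulate {S : Set QueryOp} {u : Uniformity} {c : ℕ → Circuit}
    (hc : IsEfficientOracleCircuit (Query.controlled '' S) u c) :
    ∃ (M : ℕ) (p : Polynomial ℕ), 2 < M ∧
      IsEfficientOracleCircuit (Query.uncontrolled '' S) u
        (fun n => prepare M n ++ simulate M n 1 (c n)) ∧
      ∀ n, 1 ≤ n → (c n).Allowed (Query.controlled '' S) ∧ (∀ g ∈ c n, g.ArraysLT M) ∧
        controlledCount (c n) ≤ p.eval n := by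
  obtain ⟨P, p, a, ha, h⟩ := hc
  obtain ⟨M, hP, hM⟩ := (P.eventually_boundedBy.and (eventually_gt_atTop 2)).exists
  refine ⟨M, p, hM, ⟨.seq (prepareProg M) (simulateProg M P),
    24 * (.X + 1) ^ 2 + p * (24 * (.X + (1 + p)) ^ 2 + 1), a, ha, fun n hn => ?_⟩, fun n hn => ?_⟩
  all_goals obtain ⟨hallowed, t, s, hexec, ht⟩ := h n hn
  · refine ⟨allowed_append (allowed_prepare M n) (allowed_simulate hallowed M n 1), ?_⟩
    have hsimulate := hexec.simulate (n := n) hP (v := 1) (K := 1 + p.eval n)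
      (Nat.add_le_add_left (hexec.controlledCount_le.trans ht) 1)
    obtain ⟨t', ht', hexec'⟩ := (execLE_prepareProg hM (a n) 0).seq hsimulate
    refine ⟨t', _, hexec', ht'.trans ?_⟩
    simp only [Polynomial.eval_add, Polynomial.eval_mul, Polynomial.eval_pow, Polynomial.eval_X,
      Polynomial.eval_one, Polynomial.eval_ofNat]
    gcongr
  · exact ⟨hallowed, hexec.arraysLT hP, hexec.controlledCount_le.trans ht⟩

theorem eventually_eval_lt_two_pow (p : Polynomial ℕ) : ∀ᶠ n : ℕ in atTop, p.eval n < 2 ^ n := by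
  have hlittle : (fun n : ℕ => ((p.eval n : ℕ) : ℝ)) =o[atTop] fun n => (2 : ℝ) ^ n := by
    induction p using Polynomial.induction_on' with
    | add p q hp hq =>
      simp only [Polynomial.eval_add, Nat.cast_add]
      exact hp.add hq
    | monomial k a =>
      simp only [Polynomial.eval_monomial, Nat.cast_mul, Nat.cast_pow]
      exact (isLittleO_pow_const_const_pow_of_one_lt k one_lt_two).const_mul_left _
  filter_upwards [hlittle.bound one_half_pos] with n hn
  rw [Real.norm_of_nonneg (by positivity), Real.norm_of_nonneg (by positivity)] at hn
  have hlt : ((p.eval n : ℕ) : ℝ) < 2 ^ n := hn.trans_lt (by linarith [pow_pos two_pos n (M₀ := ℝ)])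
  exact_mod_cast hlt

theorem UnitaryFamily.IndistinguishableFromHaar.withPhase {𝒰 : UnitaryFamily} {S : Set QueryOp}
    {u : Uniformity} (h : 𝒰.IndistinguishableFromHaar (Query.uncontrolled '' S) u) :
    𝒰.withPhase.IndistinguishableFromHaar (Query.controlled '' S) u := by
  intro c hc
  obtain ⟨M, p, hM, hsim, hbound⟩ := isEfficientOracleCircuit_simulate hc
  refine (h _ hsim).congr' ?_
  filter_upwards [eventually_ge_atTop 1, eventually_eval_lt_two_pow p] with n hn hp
  obtain ⟨hallowed, harrays, hcount⟩ := hbound n hn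
  rw [keyAcceptProb_withPhase hM hallowed harrays (hcount.trans_lt hp),
    haarAcceptProb_simulate hM hallowed harrays (hcount.trans_lt hp)]

/-! ## Efficient generation -/

/-- Multiplication by the global phase `exp(2πi / 2^j)`. -/
def globalPhase (j : ℕ) : Circuit :=
  [.phase j (0, 0), .not (0, 0), .phase j (0, 0), .not (0, 0)]

theorem runLin_globalPhase {n : ℕ} (V : QMatrix n) (j : ℕ) (ψ : State) :
    runLin V (globalPhase j) ψ = Complex.exp (2 * Real.pi * Complex.I / 2 ^ j) • ψ := by
  suffices runLin V (globalPhase j) =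
      Complex.exp (2 * Real.pi * Complex.I / 2 ^ j) • LinearMap.id from
    LinearMap.congr_fun this ψ
  refine hom_ext_ket fun s => ?_
  by_cases h : ((0, 0) : Wire) ∈ s <;>
    simp [globalPhase, runLin, extend_ket, Gate.onBasis, h, mem_flip_self, flip_flip]

/-- Multiplication by `exp(2πi x / 2 ^ w.length)`, where `w` lists the binary digits of `x`, the
last one first. -/
def phaseCircuit : List Bool → Circuit
  | [] => []
  | b :: w => (if b then globalPhase (w.length + 1) else []) ++ phaseCircuit w

theorem exp_div_two_pow_succ (x k : ℕ) :
    Complex.exp (2 * Real.pi * Complex.I * x / 2 ^ (k + 1)) =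
      Complex.exp (2 * Real.pi * Complex.I * (x / 2 : ℕ) / 2 ^ k) *
        Complex.exp (2 * Real.pi * Complex.I * (x % 2 : ℕ) / 2 ^ (k + 1)) := by
  have hx : (x : ℂ) = (x % 2 : ℕ) + 2 * (x / 2 : ℕ) := by exact_mod_cast (Nat.mod_add_div x 2).symm
  rw [← Complex.exp_add, hx, pow_succ]
  congr 1
  field_simp
  ring

theorem runLin_phaseCircuit {n : ℕ} (V : QMatrix n) (k x : ℕ) (ψ : State) :
    runLin V (phaseCircuit (List.ofFn fun i : Fin k => x.testBit i)) ψ =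
      Complex.exp (2 * Real.pi * Complex.I * x / 2 ^ k) • ψ := by
  induction k generalizing x ψ with
  | zero =>
    have hexp : Complex.exp (2 * Real.pi * Complex.I * x / 2 ^ 0) = 1 := by
      rw [pow_zero, div_one, mul_comm]
      exact Complex.exp_nat_mul_two_pi_mul_I x
    rw [hexp, one_smul]
    rfl
  | succ k ih =>
    have htail : (fun i : Fin k => x.testBit (i.succ : Fin (k + 1))) =
        fun i : Fin k => (x / 2).testBit i := by
      funext i
      rw [Fin.val_succ, Nat.testBit_succ]
    rw [List.ofFn_succ, phaseCircuit, runLin_append, htail, ih, exp_div_two_pow_succ, mul_smul,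
      Fin.val_zero, Nat.testBit_zero, List.length_ofFn]
    rcases Nat.mod_two_eq_zero_or_one x with h | h
    · simp [h, runLin]
    · simp [h, runLin_globalPhase]

theorem computes_phaseMul {n : ℕ} {c : Circuit} {W : QUnitary n} {ε : ℝ}
    (h : Computes c (W : QMatrix n) ε) (x : Fin (2 ^ n)) :
    Computes (phaseCircuit (bits n x) ++ c) (phaseMul x W : QMatrix n) ε := by
  intro ψ
  have hembed : embed ((phaseMul x W : QMatrix n).mulVec ψ) =
      rootPhase n x • embed ((W : QMatrix n).mulVec ψ) := by
    rw [show (phaseMul x W : QMatrix n) = rootPhase n x • (W : QMatrix n) from rfl,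
      Matrix.smul_mulVec]
    simp only [embed, Finset.smul_sum, Pi.smul_apply, smul_smul, smul_eq_mul]
  have hrun : runCircuit (1 : QMatrix n) (phaseCircuit (bits n x) ++ c) (embed ψ) =
      rootPhase n x • runCircuit (1 : QMatrix n) c (embed ψ) := by
    rw [runCircuit_eq_runLin, runCircuit_eq_runLin, runLin_append, bits, runLin_phaseCircuit,
      map_smul]
    rfl
  rw [hembed, hrun, ← smul_sub, l2norm, normSq_smul, norm_rootPhase, one_pow, one_mul]
  exact h ψ

theorem allowed_phaseCircuit (Q : Set Query) (w : List Bool) : (phaseCircuit w).Allowed Q := by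
  induction w with
  | nil => exact List.forall_mem_nil _
  | cons b w ih =>
    refine allowed_append ?_ ih
    split_ifs <;> simp [globalPhase, Circuit.Allowed, Gate.Allowed]

/-- A program for `phaseCircuit w`. The bits `w` are on top of register `1`, and `w.length` is in
register `4`; register `3` is empty. -/
def phaseProg : Prog :=
  .loop 4 (.seq (.branch 1 .skip .skip
    (emitAll [.phase 4 (0, 3), .not (0, 3), .phase 4 (0, 3), .not (0, 3)]))
      (.seq (.pop 1) (.pop 4)))

theorem execLE_phaseProg (s : Store) (w l : List Bool) :
    ExecLE phaseProg (withAux 3 (Function.update s 1 (w ++ l)) [0, w.length, 0, 0, 0])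
      (phaseCircuit w) (w.length * (2 * w.length + 11) + 1)
      (withAux 3 (Function.update s 1 l) [0, 0, 0, 0, 0]) := by
  induction w with
  | nil => exact (Exec.loopDone rfl).execLE.mono (by omega)
  | cons b w ih =>
    let σ (w' : List Bool) (u : ℕ) : Store :=
      withAux 3 (Function.update s 1 (w' ++ l)) [0, u, 0, 0, 0]
    have hbranch : ExecLE (.branch 1 .skip .skip
        (emitAll [.phase 4 (0, 3), .not (0, 3), .phase 4 (0, 3), .not (0, 3)]))
        (σ (b :: w) (w.length + 1)) (if b then globalPhase (w.length + 1) else [])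
        (2 * w.length + 8) (σ (b :: w) (w.length + 1)) := by
      cases b
      · exact ⟨1 + 1, by omega, .branchFalse rfl (.skip _)⟩
      · obtain ⟨t, ht, hexec⟩ := execLE_emitAll (s := σ (true :: w) (w.length + 1))
          (gs := [.phase 4 (0, 3), .not (0, 3), .phase 4 (0, 3), .not (0, 3)])
          (c := globalPhase (w.length + 1)) (B := 2 * w.length + 7)
          (by simp [Gate.map, globalPhase, σ, withAux])
          (by simp [totalCost, globalPhase, Gate.cost]; omega)
        exact ⟨t + 1, by omega, .branchTrue rfl hexec⟩
    have hpop : ExecLE (.pop 1) (σ (b :: w) (w.length + 1)) [] 1 (σ w (w.length + 1)) := by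
      have h := Exec.pop 1 (σ (b :: w) (w.length + 1))
      rw [update_withAux_of_lt _ _ (by omega), Function.update_idem] at h
      exact h.execLE
    have hround := hbranch.seq_nil (hpop.seq_nil
      (execLE_pop 3 _ [0, w.length + 1, 0, 0, 0] (a := 1) (by simp)))
    refine (ExecLE.loopStep (by simp [σ, withAux]) hround ih).mono ?_
    simp only [List.length_cons]
    nlinarith

theorem UnitaryFamily.EfficientlyGenerated.withPhase {𝒰 : UnitaryFamily}
    (h : 𝒰.EfficientlyGenerated) : 𝒰.withPhase.EfficientlyGenerated := by
  obtain ⟨P, p, h⟩ := h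
  refine ⟨.seq (.seq (copyProg 3) phaseProg) P, 20 * (.X + 1) ^ 2 + p, fun n hn ⟨k, x⟩ m => ?_⟩
  obtain ⟨c, t, s, hexec, ht, hallowed, hcomputes⟩ := h n hn k m
  let w := bits n x
  have hw : w.length = n := List.length_ofFn
  have hcopy := execLE_copyProg (M := 3) (s := inputStore n (w ++ 𝒰.encode n k) m) (n := n)
    (by omega) rfl
  have hphase := execLE_phaseProg (inputStore n (w ++ 𝒰.encode n k) m) w (𝒰.encode n k)
  have hinput (l l' : List Bool) : Function.update (inputStore n l m) 1 l' = inputStore n l' m := by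
    funext r
    rcases r with _ | _ | _ | r <;> rfl
  rw [withAux_inputStore (by omega)] at hcopy
  rw [hw, hinput, hinput, withAux_inputStore (by omega)] at hphase
  obtain ⟨t', ht', hexec'⟩ := hcopy.nil_seq hphase
  refine ⟨phaseCircuit w ++ c, t' + t, s, .seq hexec' hexec, ?_,
    allowed_append (allowed_phaseCircuit ∅ w) hallowed, computes_phaseMul hcomputes x⟩
  simp only [Polynomial.eval_add, Polynomial.eval_mul, Polynomial.eval_pow, Polynomial.eval_X,
    Polynomial.eval_one, Polynomial.eval_ofNat]
  nlinarith [Nat.zero_le (n * m)]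

end PRU

end

theorem corollary1p4 (𝒰 : PRU.UnitaryFamily) (S : Set PRU.QueryOp) (u : PRU.Uniformity)
    (h : 𝒰.IsPRU (PRU.Query.uncontrolled '' S) u) :
    𝒰.withPhase.IsPRU (PRU.Query.controlled '' S) u :=
  ⟨h.1.withPhase, h.2.withPhase⟩
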